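/- **Conventions.** Fix sets of identifiers $\mathit{Tid}$ (threads = transactions), locations $\mathit{Loc}$, values $\mathit{Val}$, library operations $\mathit{Op}$ and library values $V$. A *history* is a finite sequence of invocations $inv_t(i)$, responses $res_t(o)$ and crash events $c$; $ops(h)$ is $h$ without its crashes, the *eras* of $h$ are its maximal segments between crashes, and $h|_t$ is the projection to the events of $t$. In a *library* history, invocations are $inv_t(op(x))$ and responses $res_t(op(y))$ with $op\in\mathit{Op}$, $x,y\in V$. In a *transactional* history, invocations are $\mathtt{Begin}$, $\mathtt{Rd}(l)$, $\mathtt{Wr}(l,v)$, $\mathtt{Commit}$, and each operation is answered by a normal response ($\mathtt{ok}$, for a read a value) or by an abort of this operation. A crash-free history is *sequential* if it consists of invocations each directly followed by its matching response (same identifier, same operation), where only a last invocation may lack a response. A history is *well-formed* if every $ops(h)|_t$ is sequential and every identifier occurs in at most one era. $complete(h)$ removes the invocations without matching response. Crash-free histories are *equivalent* ($\equiv$) if their projections to every $t$ agree. **Automata.** An IOA has states, start states and transitions labelled by external or internal actions; its traces are the sequences of external actions of its finite executions from start states. **Library.** A sequential object $AM$ has states, initial states, for each operation $op$ and identifier $t$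 a relation $op_t(x,s,s',y)$ (input, pre-state, post-state, output), and a relation $recover(s,s')$ (effect of crash and recovery; the identity if there is none). A library history $h$ with eras $h_0,\dots,h_n$ is *durably linearizable* to $AM$ if it is well-formed and there are sequential histories $hs_0,\dots,hs_n$, each made of invocation–response pairs, such that (i) for each $i$ there is a sequence $r_i$ of responses with $h_i':=complete(h_i r_i)\equiv hs_i$, and whenever a response precedes an invocation in $h_i'$, the corresponding occurrences are in the same order in $hs_i$; and (ii) from some initial state of $AM$, the operations of $hs_0$, a recovery, those of $hs_1$, a recovery, …, those of $hs_n$ can be executed in this order. The library used as an automaton, again written $AM$, is the canonical durable automaton: its state is an object state $s$ and a program counter $pc_t\in\{notStarted,ready,doOp(op,x),resOp(op,y),crashed\}$ for each $t$, initially an initial state and all $notStarted$; internal $run_t$: $notStarted\to ready$; $inv_t(op(x))$: $ready\to doOp(op,x)$; internal $do_t(op)$: $doOp(op,x)\to resOp(op,y)$ and $s\to s'$ with $op_t(x,s,s',y)$; $res_t(op(y))$: $resOp(op,y)\to ready$; crash: every $pc_t\ne notStarted$ becomes $crashed$ and $s\to s'$ with $recover(s,s')$. A concrete library $CM$ is any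 IOA whose external actions are invocations and responses of library operations and the crash; it is durably linearizable to $AM$ if all its traces are. An STM $T$ is any IOA whose external actions are transactional events, library events and the crash. $T[L]$ is the product of $T$ and a library $L$, synchronized exactly on library events and the crash; $traces(T[L])|_T$ are its traces restricted to transactional events and crashes. **dTMS2.** For a set $Init$ of initial memories $\mathit{Loc}\to\mathit{Val}$, dTMS2 has the state: a sequence $mems$ of memories, initially $\langle m_0\rangle$ with $m_0\in Init$; and for each $t$ a program counter $pc_t$ (initially $notStarted$), an index $beginIdx_t$ (initially arbitrary), and partial functions $rdSet_t,wrSet_t$ from locations to values (initially empty). Let $validIdx(t,n)$ mean $beginIdx_t\le n<len(mems)$ and $rdSet_t\subseteq mems(n)$. External steps: begin invocation $notStarted\to beginPending$, setting $beginIdx_t:=len(mems)-1$; begin response $beginPending\to ready$; read $ready\to doRead(l)$ and $resRead(v)\to ready$; write $ready\to doWrite(l,v)$ and $resWrite\to ready$; commit $ready\to doCommit$ and $resCommit\to committed$; abort response of the current operation, to $aborted$, from $beginPending$, $doRead$, $resRead$, $doWrite$, $resWrite$ or $doCommit$; crash: each $pc_t\notin\{notStarted,committed\}$ becomes $aborted$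 and $mems:=\langle last(mems)\rangle$. Internal steps: $doWrite(l,v)\to resWrite$, setting $wrSet_t(l):=v$; $doRead(l)\to resRead(wrSet_t(l))$ if $l\in dom(wrSet_t)$; $doRead(l)\to resRead(v)$ with $v=mems(n)(l)$ if $l\notin dom(wrSet_t)$ and $validIdx(t,n)$, setting $rdSet_t(l):=v$; $doCommit\to resCommit$ if $wrSet_t=\emptyset$ and $validIdx(t,n)$ for some $n$; $doCommit\to resCommit$ if $rdSet_t\subseteq last(mems)$, appending $last(mems)\oplus wrSet_t$ to $mems$. **Durable opacity.** Let $m_0$ be a memory. A sequential transactional history is *legal* (from $m_0$) if, executed from $m_0$, each successful read returns the current value of its location, where successful writes update the memory and all other operations have no effect. A history $hs$ is *transaction sequential* if it is sequential and the events of each transaction are contiguous; it is *valid* if for each event $e$ in it, the part of $hs$ up to and including $e$, restricted to the transactions committed in $hs$ and the transaction of $e$, is legal. A crash-free history $h$ is *end-to-end opaque* if there are a sequence $r$ of responses and a transaction sequential valid $hs$ with $complete(hr)\equiv hs$ such that, whenever $t_1$ commits before $t_2$ begins in $h$, the same holds in $hs$; it is *opaque* if all its prefixes are end-to-end opaque.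 A transactional history $h$ is *durably opaque* from $m_0$ if it is well-formed, each nonempty $ops(h)|_t$ starts with its only $\mathtt{Begin}$ invocation and has no event after a successful commit or an abort, and $ops(h)$ is opaque. **Theorem.** Suppose $CM$ is durably linearizable to $AM$ and $T[AM]$ refines dTMS2, i.e. $traces(T[AM])|_T\subseteq traces(\mathrm{dTMS2})$. Then $T[CM]$ is durably opaque: for every $h\in traces(T[CM])|_T$ there is $m_0\in Init$ such that $h$ is durably opaque from $m_0$. -/

import Mathlib

namespace DurableSTM

/-! ### Events and histories -/

/-- Invocation and response events of thread (or transaction) `t`. The invocation `i : I` names an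
operation together with its input, the response `o : O` an operation together with its output. -/
inductive OpEvent (Tid I O : Type*) where
  | inv (t : Tid) (i : I)
  | res (t : Tid) (o : O)

/-- An event of a history: an operation event or a system-wide crash. -/
inductive Event (E : Type*) where
  | op (e : E)
  | crash

namespace OpEvent

variable {Tid I O : Type*}

def tid : OpEvent Tid I O → Tid
  | inv t _ => t
  | res t _ => t

def IsInv : OpEvent Tid I O → Prop
  | inv _ _ => True
  | res _ _ => False

def IsRes : OpEvent Tid I O → Prop
  | inv _ _ => False
  | res _ _ => True

/-- The first event is an invocation, the second a response of the same operation by the same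
thread; `m i o` says that `i` and `o` belong to the same operation. -/
def Matches (m : I → O → Prop) : OpEvent Tid I O → OpEvent Tid I O → Prop
  | inv t i, res t' o => t = t' ∧ m i o
  | _, _ => False

end OpEvent

/-- The history without its crash events. -/
def ops {E : Type*} (h : List (Event E)) : List E :=
  h.filterMap fun e => match e with
    | .op e => some e
    | .crash => none

/-- The eras of a history: the maximal segments between crashes (`n` crashes give `n + 1` eras,
some of them possibly empty). -/
def eras {E : Type*} : List (Event E) → List (List E)
  | [] => [[]]
  | .crash :: h => [] :: eras h
  | .op e :: h => match eras h with
    | [] => [[e]]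
    | x :: xs => (e :: x) :: xs

section Histories

variable {Tid I O : Type*}

/-- The projection of a crash-free history onto the events of `t`. -/
def proj [DecidableEq Tid] (h : List (OpEvent Tid I O)) (t : Tid) : List (OpEvent Tid I O) :=
  h.filter fun e => e.tid = t

/-- Every invocation, except possibly a last one, is directly followed by its matching response,
and there are no other responses. -/
def Sequential (m : I → O → Prop) : List (OpEvent Tid I O) → Prop
  | [] => True
  | [e] => e.IsInv
  | e :: r :: h => e.Matches m r ∧ Sequential m h

open Classical in
/-- Removal of the pending operations: an invocation is dropped unless the next event of its thread
is a matching response. -/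
noncomputable def complete [DecidableEq Tid] (m : I → O → Prop) :
    List (OpEvent Tid I O) → List (OpEvent Tid I O)
  | [] => []
  | e :: h =>
      if e.IsInv ∧ ¬ ∃ r, (proj h e.tid).head? = some r ∧ e.Matches m r
      then complete m h
      else e :: complete m h

/-- Well-formedness of a history with crashes: every thread is sequential, and occurs in at most
one era. -/
def WellFormed [DecidableEq Tid] (m : I → O → Prop) (h : List (Event (OpEvent Tid I O))) : Prop :=
  (∀ t, Sequential m (proj (ops h) t)) ∧
  ∀ (i j : ℕ) (x y : List (OpEvent Tid I O)), (eras h)[i]? = some x → (eras h)[j]? = some y →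
    ∀ e ∈ x, ∀ f ∈ y, e.tid = f.tid → i = j

/-- Real-time order of operations. Occurrences of events are identified by their thread and their
position within the thread: the event number `k` of `t₁` is a response and precedes the event
number `l` of `t₂`, which is an invocation. -/
def RealTime [DecidableEq Tid] (h : List (OpEvent Tid I O)) (t₁ : Tid) (k : ℕ) (t₂ : Tid) (l : ℕ) :
    Prop :=
  ∃ h₀ e₁ h₁ e₂ h₂, h = h₀ ++ e₁ :: (h₁ ++ e₂ :: h₂) ∧
    e₁.IsRes ∧ e₁.tid = t₁ ∧ (proj h₀ t₁).length = k ∧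
    e₂.IsInv ∧ e₂.tid = t₂ ∧ (proj (h₀ ++ e₁ :: h₁) t₂).length = l

/-- The crash-free history `h` is linearized by the sequential history `hs`: `h` can be extended by
responses to some of the pending operations so that, after removal of the operations that are still
pending, it is equivalent to `hs` and `hs` preserves its real-time order. -/
def LinearizedBy [DecidableEq Tid] (m : I → O → Prop) (h hs : List (OpEvent Tid I O)) : Prop :=
  ∃ h₀ : List (OpEvent Tid I O), (∀ e ∈ h₀, e.IsRes) ∧
    (∀ t, proj (complete m (h ++ h₀)) t = proj hs t) ∧
    ∀ t₁ k t₂ l, RealTime (complete m (h ++ h₀)) t₁ k t₂ l → RealTime hs t₁ k t₂ l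

/-- `LegalRun R s h s'`: `h` is a sequence of invocation-response pairs that leads from state `s`
to state `s'` by steps of the operations `R`. -/
inductive LegalRun {S : Type*} (R : Tid → I → S → S → O → Prop) :
    S → List (OpEvent Tid I O) → S → Prop
  | nil (s : S) : LegalRun R s [] s
  | cons {t : Tid} {i : I} {o : O} {s s' s'' : S} {h : List (OpEvent Tid I O)} :
      R t i s s' o → LegalRun R s' h s'' →
      LegalRun R s (OpEvent.inv t i :: OpEvent.res t o :: h) s''

end Histories

/-! ### Input/output automata -/

/-- An input/output automaton with external actions `E` and internal actions `I`. The division of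
the external actions into inputs and outputs has no influence on traces, refinement and products,
and is not recorded. -/
structure IOA (E : Type*) (I : Type*) where
  State : Type*
  start : Set State
  trans : State → E ⊕ I → State → Prop

/-- Finite executions, with the list of their actions. -/
inductive IOA.Exec {E I : Type*} (A : IOA E I) : A.State → List (E ⊕ I) → A.State → Prop
  | nil (s : A.State) : IOA.Exec A s [] s
  | cons {s s' s'' : A.State} {a : E ⊕ I} {as : List (E ⊕ I)} :
      A.trans s a s' → IOA.Exec A s' as s'' → IOA.Exec A s (a :: as) s''

/-- The external actions of the executions that begin in a start state. -/
def IOA.traces {E I : Type*} (A : IOA E I) : Set (List E) :=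
  {h | ∃ s ∈ A.start, ∃ as s', A.Exec s as s' ∧ h = as.filterMap Sum.getLeft?}

/-! ### Sequential objects, durable linearizability and the durable automaton -/

/-- A sequential object with operations `Op` and values `V`. The effect of an operation may depend
on the calling thread, and `recover` is the effect of a crash and the subsequent recovery on the
state (the identity relation for an object that needs no recovery). -/
structure SeqObject (Tid Op V : Type*) where
  State : Type*
  init : Set State
  op : Op → Tid → V → State → State → V → Prop
  recover : State → State → Prop

/-- Histories of a library with operations `Op` are lists of these events. -/
abbrev LibOpEvent (Tid Op V : Type*) := OpEvent Tid (Op × V) (Op × V)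

abbrev LibEvent (Tid Op V : Type*) := Event (LibOpEvent Tid Op V)

def libMatch {Op V : Type*} (i o : Op × V) : Prop := i.1 = o.1

namespace SeqObject

variable {Tid Op V : Type*} (S : SeqObject Tid Op V)

/-- One complete operation, with the operation name attached to input and output. -/
def Step (t : Tid) (i : Op × V) (s s' : S.State) (o : Op × V) : Prop :=
  i.1 = o.1 ∧ S.op i.1 t i.2 s s' o.2

/-- `S.LegalEras s [h₀, …, hₙ]`: from state `s`, the sequential histories `h₀, …, hₙ` can be
executed one after the other, with a recovery between any two of them. -/
inductive LegalEras : S.State → List (List (LibOpEvent Tid Op V)) → Prop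
  | last {s s' : S.State} {h : List (LibOpEvent Tid Op V)} :
      LegalRun S.Step s h s' → LegalEras s [h]
  | crash {s s' s'' : S.State} {h : List (LibOpEvent Tid Op V)}
      {hs : List (List (LibOpEvent Tid Op V))} :
      LegalRun S.Step s h s' → S.recover s' s'' → LegalEras s'' hs → LegalEras s (h :: hs)

/-- Durable linearizability of a history: it is well-formed, and its eras are linearized by
sequential histories that together, with the recoveries in between, are legal. An operation that is
pending at a crash takes effect before the crash or not at all. -/
def DurablyLinearizable [DecidableEq Tid] (h : List (LibEvent Tid Op V)) : Prop :=
  WellFormed libMatch h ∧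
  ∃ hs, (∃ s ∈ S.init, S.LegalEras s hs) ∧ List.Forall₂ (LinearizedBy libMatch) (eras h) hs

end SeqObject

/-- Program counters of the durable automaton. -/
inductive DurPC (Op V : Type*) where
  | notStarted
  | ready
  | doOp (k : Op) (x : V)
  | resOp (k : Op) (y : V)
  | crashed

/-- No thread that has started survives a crash. -/
def DurPC.afterCrash {Op V : Type*} : DurPC Op V → DurPC Op V
  | .notStarted => .notStarted
  | _ => .crashed

inductive DurInternal (Tid Op : Type*) where
  | run (t : Tid)
  | doOp (t : Tid) (k : Op)

inductive SeqObject.DurStep {Tid Op V : Type*} [DecidableEq Tid] (S : SeqObject Tid Op V) :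
    S.State × (Tid → DurPC Op V) → LibEvent Tid Op V ⊕ DurInternal Tid Op →
    S.State × (Tid → DurPC Op V) → Prop
  | run {s : S.State} {pc : Tid → DurPC Op V} {t : Tid} :
      pc t = .notStarted →
      SeqObject.DurStep S (s, pc) (.inr (.run t)) (s, Function.update pc t .ready)
  | inv {s : S.State} {pc : Tid → DurPC Op V} {t : Tid} {k : Op} {x : V} :
      pc t = .ready →
      SeqObject.DurStep S (s, pc) (.inl (.op (.inv t (k, x))))
        (s, Function.update pc t (.doOp k x))
  | doOp {s s' : S.State} {pc : Tid → DurPC Op V} {t : Tid} {k : Op} {x y : V} :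
      pc t = .doOp k x → S.op k t x s s' y →
      SeqObject.DurStep S (s, pc) (.inr (.doOp t k)) (s', Function.update pc t (.resOp k y))
  | res {s : S.State} {pc : Tid → DurPC Op V} {t : Tid} {k : Op} {y : V} :
      pc t = .resOp k y →
      SeqObject.DurStep S (s, pc) (.inl (.op (.res t (k, y)))) (s, Function.update pc t .ready)
  | crashRecovery {s s' : S.State} {pc : Tid → DurPC Op V} :
      S.recover s s' →
      SeqObject.DurStep S (s, pc) (.inl .crash) (s', fun t => (pc t).afterCrash)

/-- The canonical durable automaton of a sequential object. -/
def SeqObject.durAut {Tid Op V : Type*} [DecidableEq Tid] (S : SeqObject Tid Op V) :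
    IOA (LibEvent Tid Op V) (DurInternal Tid Op) where
  State := S.State × (Tid → DurPC Op V)
  start := {p | p.1 ∈ S.init ∧ ∀ t, p.2 t = .notStarted}
  trans := S.DurStep

/-! ### Transactional histories and durable opacity -/

inductive TMOp where
  | begin
  | read
  | write
  | commit

inductive TMInv (Loc Val : Type*) where
  | begin
  | read (l : Loc)
  | write (l : Loc) (v : Val)
  | commit

inductive TMRes (Val : Type*) where
  | beginOk
  | readVal (v : Val)
  | writeOk
  | commitOk
  | abort (k : TMOp)

def TMInv.op {Loc Val : Type*} : TMInv Loc Val → TMOp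
  | .begin => .begin
  | .read _ => .read
  | .write _ _ => .write
  | .commit => .commit

def TMRes.op {Val : Type*} : TMRes Val → TMOp
  | .beginOk => .begin
  | .readVal _ => .read
  | .writeOk => .write
  | .commitOk => .commit
  | .abort k => k

abbrev TMOpEvent (Tid Loc Val : Type*) := OpEvent Tid (TMInv Loc Val) (TMRes Val)

abbrev TMEvent (Tid Loc Val : Type*) := Event (TMOpEvent Tid Loc Val)

def tmMatch {Loc Val : Type*} (i : TMInv Loc Val) (o : TMRes Val) : Prop := i.op = o.op

/-- The sequential semantics of the transactional operations on a memory; an aborted operation has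
no effect. -/
inductive TMStep {Tid Loc Val : Type*} [DecidableEq Loc] (t : Tid) :
    TMInv Loc Val → (Loc → Val) → (Loc → Val) → TMRes Val → Prop
  | begin (m : Loc → Val) : TMStep t .begin m m .beginOk
  | read (l : Loc) (m : Loc → Val) : TMStep t (.read l) m m (.readVal (m l))
  | write (l : Loc) (v : Val) (m : Loc → Val) :
      TMStep t (.write l v) m (Function.update m l v) .writeOk
  | commit (m : Loc → Val) : TMStep t .commit m m .commitOk
  | abort (i : TMInv Loc Val) (m : Loc → Val) : TMStep t i m m (.abort i.op)

section Opacity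

variable {Tid Loc Val : Type*}

/-- Legal sequential transactional histories with initial memory `m₀`; a last invocation that has
no response imposes no condition. -/
def TMLegal [DecidableEq Loc] (m₀ : Loc → Val) (h : List (TMOpEvent Tid Loc Val)) : Prop :=
  (∃ m, LegalRun TMStep m₀ h m) ∨
  ∃ h₁ t i, h = h₁ ++ [OpEvent.inv t i] ∧ ∃ m, LegalRun TMStep m₀ h₁ m

def Committed (h : List (TMOpEvent Tid Loc Val)) (t : Tid) : Prop :=
  OpEvent.res t .commitOk ∈ h

/-- Well-formed, and every transaction starts with its only `begin` and ends with its first commit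
or abort. -/
def TransactionWellFormed [DecidableEq Tid] (h : List (TMEvent Tid Loc Val)) : Prop :=
  WellFormed tmMatch h ∧
  ∀ t i e, (proj (ops h) t)[i]? = some e →
    (i = 0 ↔ e = OpEvent.inv t .begin) ∧
    (i + 1 < (proj (ops h) t).length →
      e ≠ OpEvent.res t .commitOk ∧ ∀ k, e ≠ OpEvent.res t (.abort k))

/-- Sequential, and the events of each transaction are contiguous. -/
def TransactionSequential (h : List (TMOpEvent Tid Loc Val)) : Prop :=
  Sequential tmMatch h ∧
  ∀ h₀ e₁ h₁ e₂ h₂, h = h₀ ++ e₁ :: (h₁ ++ e₂ :: h₂) → e₁.tid = e₂.tid →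
    ∀ e ∈ h₁, e.tid = e₁.tid

open Classical in
/-- Validity at every index: the part of the history up to (and with) any event `e`, restricted to
the committed transactions and the transaction of `e`, is legal. -/
def Valid [DecidableEq Loc] (m₀ : Loc → Val) (h : List (TMOpEvent Tid Loc Val)) : Prop :=
  ∀ i e, h[i]? = some e →
    TMLegal m₀ ((h.take (i + 1)).filter fun f => Committed h f.tid ∨ f.tid = e.tid)

/-- Real-time order of transactions: `t₁` commits before `t₂` begins. -/
def TMRealTime (h : List (TMOpEvent Tid Loc Val)) (t₁ t₂ : Tid) : Prop :=
  ∃ h₀ h₁ h₂, h = h₀ ++ OpEvent.res t₁ .commitOk :: (h₁ ++ OpEvent.inv t₂ .begin :: h₂)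

def EndToEndOpaque [DecidableEq Tid] [DecidableEq Loc] (m₀ : Loc → Val)
    (h : List (TMOpEvent Tid Loc Val)) : Prop :=
  ∃ h₀ : List (TMOpEvent Tid Loc Val), (∀ e ∈ h₀, e.IsRes) ∧
    ∃ hs, TransactionSequential hs ∧ Valid m₀ hs ∧
      (∀ t, proj (complete tmMatch (h ++ h₀)) t = proj hs t) ∧
      ∀ t₁ t₂, TMRealTime h t₁ t₂ → TMRealTime hs t₁ t₂

def Opaque [DecidableEq Tid] [DecidableEq Loc] (m₀ : Loc → Val)
    (h : List (TMOpEvent Tid Loc Val)) : Prop :=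
  ∀ h', h' <+: h → EndToEndOpaque m₀ h'

def DurablyOpaque [DecidableEq Tid] [DecidableEq Loc] (m₀ : Loc → Val)
    (h : List (TMEvent Tid Loc Val)) : Prop :=
  TransactionWellFormed h ∧ Opaque m₀ (ops h)

end Opacity

/-! ### The automaton dTMS2 -/

inductive TMPC (Loc Val : Type*) where
  | notStarted
  | beginPending
  | ready
  | doRead (l : Loc)
  | resRead (v : Val)
  | doWrite (l : Loc) (v : Val)
  | resWrite
  | doCommit
  | resCommit
  | committed
  | aborted

/-- The operation that can answer with an abort; `none` if an abort is not possible. -/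
def TMPC.abortable {Loc Val : Type*} : TMPC Loc Val → Option TMOp
  | .beginPending => some .begin
  | .doRead _ => some .read
  | .resRead _ => some .read
  | .doWrite _ _ => some .write
  | .resWrite => some .write
  | .doCommit => some .commit
  | _ => none

def TMPC.afterCrash {Loc Val : Type*} : TMPC Loc Val → TMPC Loc Val
  | .notStarted => .notStarted
  | .committed => .committed
  | _ => .aborted

structure DTMS2State (Tid Loc Val : Type*) where
  mems : List (Loc → Val)
  pc : Tid → TMPC Loc Val
  beginIdx : Tid → ℕ
  rdSet : Tid → Loc → Option Val
  wrSet : Tid → Loc → Option Val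

inductive DTMS2Internal (Tid Loc Val : Type*) where
  | doRead (t : Tid) (l : Loc) (n : ℕ)
  | doWrite (t : Tid) (l : Loc) (v : Val)
  | doCommitReadOnly (t : Tid) (n : ℕ)
  | doCommitWriter (t : Tid)

section DTMS2

variable {Tid Loc Val : Type*}

/-- Inclusion of a partial function in a memory. -/
def SubMem (f : Loc → Option Val) (m : Loc → Val) : Prop := ∀ l v, f l = some v → m l = v

/-- Functional override of a memory by a partial function. -/
def overrideMem (m : Loc → Val) (f : Loc → Option Val) : Loc → Val := fun l => (f l).getD (m l)

/-- `n` is a valid index for `t`, and `m` is the memory with this index. -/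
def DTMS2State.ValidIdx (s : DTMS2State Tid Loc Val) (t : Tid) (n : ℕ) (m : Loc → Val) : Prop :=
  s.beginIdx t ≤ n ∧ s.mems[n]? = some m ∧ SubMem (s.rdSet t) m

def DTMS2State.setPC [DecidableEq Tid] (s : DTMS2State Tid Loc Val) (t : Tid) (p : TMPC Loc Val) :
    DTMS2State Tid Loc Val :=
  { s with pc := Function.update s.pc t p }

inductive DTMS2Step [DecidableEq Tid] [DecidableEq Loc] :
    DTMS2State Tid Loc Val → TMEvent Tid Loc Val ⊕ DTMS2Internal Tid Loc Val →
    DTMS2State Tid Loc Val → Prop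
  | beginInv {s : DTMS2State Tid Loc Val} {t : Tid} :
      s.pc t = .notStarted →
      DTMS2Step s (.inl (.op (.inv t .begin)))
        { s.setPC t .beginPending with
          beginIdx := Function.update s.beginIdx t (s.mems.length - 1) }
  | beginRes {s : DTMS2State Tid Loc Val} {t : Tid} :
      s.pc t = .beginPending →
      DTMS2Step s (.inl (.op (.res t .beginOk))) (s.setPC t .ready)
  | readInv {s : DTMS2State Tid Loc Val} {t : Tid} {l : Loc} :
      s.pc t = .ready →
      DTMS2Step s (.inl (.op (.inv t (.read l)))) (s.setPC t (.doRead l))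
  | readRes {s : DTMS2State Tid Loc Val} {t : Tid} {v : Val} :
      s.pc t = .resRead v →
      DTMS2Step s (.inl (.op (.res t (.readVal v)))) (s.setPC t .ready)
  | writeInv {s : DTMS2State Tid Loc Val} {t : Tid} {l : Loc} {v : Val} :
      s.pc t = .ready →
      DTMS2Step s (.inl (.op (.inv t (.write l v)))) (s.setPC t (.doWrite l v))
  | writeRes {s : DTMS2State Tid Loc Val} {t : Tid} :
      s.pc t = .resWrite →
      DTMS2Step s (.inl (.op (.res t .writeOk))) (s.setPC t .ready)
  | commitInv {s : DTMS2State Tid Loc Val} {t : Tid} :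
      s.pc t = .ready →
      DTMS2Step s (.inl (.op (.inv t .commit))) (s.setPC t .doCommit)
  | commitRes {s : DTMS2State Tid Loc Val} {t : Tid} :
      s.pc t = .resCommit →
      DTMS2Step s (.inl (.op (.res t .commitOk))) (s.setPC t .committed)
  | abortRes {s : DTMS2State Tid Loc Val} {t : Tid} {k : TMOp} :
      (s.pc t).abortable = some k →
      DTMS2Step s (.inl (.op (.res t (.abort k)))) (s.setPC t .aborted)
  | doWrite {s : DTMS2State Tid Loc Val} {t : Tid} {l : Loc} {v : Val} :
      s.pc t = .doWrite l v →
      DTMS2Step s (.inr (.doWrite t l v))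
        { s.setPC t .resWrite with
          wrSet := Function.update s.wrSet t (Function.update (s.wrSet t) l (some v)) }
  | doCommitReadOnly {s : DTMS2State Tid Loc Val} {t : Tid} {n : ℕ} {m : Loc → Val} :
      s.pc t = .doCommit → (∀ l, s.wrSet t l = none) → s.ValidIdx t n m →
      DTMS2Step s (.inr (.doCommitReadOnly t n)) (s.setPC t .resCommit)
  | doCommitWriter {s : DTMS2State Tid Loc Val} {t : Tid} {m : Loc → Val} :
      s.pc t = .doCommit → s.mems.getLast? = some m → SubMem (s.rdSet t) m →
      DTMS2Step s (.inr (.doCommitWriter t))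
        { s.setPC t .resCommit with mems := s.mems ++ [overrideMem m (s.wrSet t)] }
  | doReadOwn {s : DTMS2State Tid Loc Val} {t : Tid} {l : Loc} {v : Val} {n : ℕ} :
      s.pc t = .doRead l → s.wrSet t l = some v →
      DTMS2Step s (.inr (.doRead t l n)) (s.setPC t (.resRead v))
  | doReadMem {s : DTMS2State Tid Loc Val} {t : Tid} {l : Loc} {n : ℕ} {m : Loc → Val} :
      s.pc t = .doRead l → s.wrSet t l = none → s.ValidIdx t n m →
      DTMS2Step s (.inr (.doRead t l n))
        { s.setPC t (.resRead (m l)) with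
          rdSet := Function.update s.rdSet t (Function.update (s.rdSet t) l (some (m l))) }
  | crashRecovery {s : DTMS2State Tid Loc Val} {m : Loc → Val} :
      s.mems.getLast? = some m →
      DTMS2Step s (.inl .crash) { s with pc := fun t => (s.pc t).afterCrash, mems := [m] }

end DTMS2

/-- The automaton dTMS2, for a set `Init` of initial memories. -/
def dTMS2 (Tid : Type*) {Loc Val : Type*} [DecidableEq Tid] [DecidableEq Loc]
    (Init : Set (Loc → Val)) :
    IOA (TMEvent Tid Loc Val) (DTMS2Internal Tid Loc Val) where
  State := DTMS2State Tid Loc Val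
  start := {s | (∃ m₀ ∈ Init, s.mems = [m₀]) ∧ (∀ t, s.pc t = .notStarted) ∧
    (∀ t l, s.rdSet t l = none) ∧ ∀ t l, s.wrSet t l = none}
  trans := DTMS2Step

/-! ### STMs that use a library -/

/-- External actions of an STM that calls a library: the invocations and responses of its
transactional operations, those of the library calls, and the crash. -/
inductive CtxEvent (Tid Loc Val Op V : Type*) where
  | tm (e : TMOpEvent Tid Loc Val)
  | lib (e : LibOpEvent Tid Op V)
  | crash

section Context

variable {Tid Loc Val Op V J K : Type*}

def CtxEvent.toTM : CtxEvent Tid Loc Val Op V → Option (TMEvent Tid Loc Val)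
  | .tm e => some (.op e)
  | .lib _ => none
  | .crash => some .crash

/-- The external actions that are shared with the library. -/
def CtxEvent.toLib : CtxEvent Tid Loc Val Op V → Option (LibEvent Tid Op V)
  | .tm _ => none
  | .lib e => some (.op e)
  | .crash => some .crash

/-- The product `T[L]` of the STM `T` and the library `L`, synchronized on the library calls and
the crash. -/
def IOA.withLib (T : IOA (CtxEvent Tid Loc Val Op V) J) (L : IOA (LibEvent Tid Op V) K) :
    IOA (CtxEvent Tid Loc Val Op V) (J ⊕ K) where
  State := T.State × L.State
  start := T.start ×ˢ L.start
  trans := fun s a s' => match a with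
    | .inl e => T.trans s.1 (.inl e) s'.1 ∧
        (match e.toLib with
          | some x => L.trans s.2 (.inl x) s'.2
          | none => s'.2 = s.2)
    | .inr (.inl j) => T.trans s.1 (.inr j) s'.1 ∧ s'.2 = s.2
    | .inr (.inr k) => s'.1 = s.1 ∧ L.trans s.2 (.inr k) s'.2

/-- The traces restricted to the events of the STM (transactional events and crashes). -/
def IOA.tmTraces (A : IOA (CtxEvent Tid Loc Val Op V) J) : Set (List (TMEvent Tid Loc Val)) :=
  {h | ∃ tr ∈ A.traces, h = tr.filterMap CtxEvent.toTM}

end Context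

end DurableSTM

namespace DurableSTM

/-! The proof factors through `T[AM]`. Durable linearizability makes every trace of `CM` a trace of
the durable automaton (`SeqObject.DurablyLinearizable.mem_traces`), and products are monotone in the
library (`IOA.tmTraces_withLib_subset`). So every history of `T[CM]` is one of `T[AM]`, hence a
trace of dTMS2, and it remains that traces of dTMS2 are durably opaque
(`exists_durablyOpaque_of_mem_traces`).

For the library, the events of an era are executed in the given order, and operations take effect
lazily, in the order of the linearization: only when a response needs it, or at the end of the era.
The next operation of the linearization has then been invoked, since otherwise it would follow that
response in real time. `EraSim` is the invariant, `EraSim.exists_run` the induction. Pending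
operations that are not linearized stay at `doOp`.

For dTMS2, `OpacityInv` carries a list of all started transactions whose serial execution produces
the memories. It is sorted by an index: those with index at most `n` produce memory `n`. A
transaction whose commit has not taken effect does not change the memory, so it can be moved: a
begin, a read from memory and a read-only commit put it behind all transactions with index at most
that of the memory used, a writing commit puts it last. This respects real time, because `beginIdx`
bounds the indices of all transactions that committed before the begin, and an uncommitted
transaction precedes none. A crash resets the indices and keeps the list. The operations of a
transaction give the same results from every memory that contains its read set. Hence the list, with
pending operations completed by an abort, or by a commit that has taken effect, is a valid serial
history (`OpacityInv.endToEndOpaque`). -/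

/-! ### Runs of automata -/

/-- `A.Run s h s'`: some execution from `s` to `s'` has the trace `h`. -/
inductive IOA.Run {E I : Type*} (A : IOA E I) : A.State → List E → A.State → Prop
  | refl (s : A.State) : IOA.Run A s [] s
  | external {s s' s'' : A.State} {e : E} {h : List E} :
      A.trans s (.inl e) s' → IOA.Run A s' h s'' → IOA.Run A s (e :: h) s''
  | internal {s s' s'' : A.State} {i : I} {h : List E} :
      A.trans s (.inr i) s' → IOA.Run A s' h s'' → IOA.Run A s h s''

namespace IOA

variable {E I : Type*} {A : IOA E I}

theorem run_iff_exec {s s' : A.State} {h : List E} :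
    A.Run s h s' ↔ ∃ as, A.Exec s as s' ∧ h = as.filterMap Sum.getLeft? := by
  constructor
  · intro hr
    induction hr with
    | refl s => exact ⟨[], .nil s, rfl⟩
    | @external _ _ _ e _ ht _ ih =>
      obtain ⟨as, ha, rfl⟩ := ih
      exact ⟨.inl e :: as, .cons ht ha, rfl⟩
    | @internal _ _ _ i _ ht _ ih =>
      obtain ⟨as, ha, rfl⟩ := ih
      exact ⟨.inr i :: as, .cons ht ha, rfl⟩
  · rintro ⟨as, ha, rfl⟩
    induction ha with
    | nil s => exact .refl s
    | @cons s _ _ a as ht he ih =>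
      cases a with
      | inl e => exact .external ht ih
      | inr i => exact .internal ht ih

theorem mem_traces_iff {h : List E} : h ∈ A.traces ↔ ∃ s ∈ A.start, ∃ s', A.Run s h s' := by
  constructor
  · rintro ⟨s, hs, as, s', he, rfl⟩
    exact ⟨s, hs, s', run_iff_exec.2 ⟨as, he, rfl⟩⟩
  · rintro ⟨s, hs, s', hr⟩
    obtain ⟨as, he, rfl⟩ := run_iff_exec.1 hr
    exact ⟨s, hs, as, s', he, rfl⟩

theorem Run.append {s s' s'' : A.State} {h h' : List E} (h₁ : A.Run s h s')
    (h₂ : A.Run s' h' s'') : A.Run s (h ++ h') s'' := by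
  induction h₁ with
  | refl => exact h₂
  | external ht _ ih => exact .external ht (ih h₂)
  | internal ht _ ih => exact .internal ht (ih h₂)

/-- Opacity concerns every prefix, so the invariant is needed in intermediate states. The shorter
run has the same start state, hence the same initial memory. -/
theorem Run.of_prefix {s s' : A.State} {h g : List E} (hr : A.Run s h s') (hg : g <+: h) :
    ∃ s'', A.Run s g s'' := by
  induction hr generalizing g with
  | refl s =>
    obtain rfl := List.prefix_nil.1 hg
    exact ⟨s, .refl s⟩
  | @external s _ _ e h ht _ ih =>
    rcases List.prefix_cons_iff.1 hg with rfl | ⟨g', rfl, hg'⟩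
    · exact ⟨s, .refl s⟩
    · obtain ⟨s'', h''⟩ := ih hg'
      exact ⟨s'', .external ht h''⟩
  | internal ht _ ih =>
    obtain ⟨s'', h''⟩ := ih hg
    exact ⟨s'', .internal ht h''⟩

theorem Run.exists_of_cons {s s' : A.State} {e : E} {h : List E} (hr : A.Run s (e :: h) s') :
    ∃ s₁ s₂, A.Run s [] s₁ ∧ A.trans s₁ (.inl e) s₂ ∧ A.Run s₂ h s' := by
  generalize hl : e :: h = l at hr
  induction hr with
  | refl => simp at hl
  | @external s s₂ _ _ _ ht hr _ =>
    simp only [List.cons.injEq] at hl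
    obtain ⟨rfl, rfl⟩ := hl
    exact ⟨s, s₂, .refl s, ht, hr⟩
  | internal ht _ ih =>
    obtain ⟨s₁, s₂, h₁, h₂, h₃⟩ := ih hl
    exact ⟨s₁, s₂, .internal ht h₁, h₂, h₃⟩

/-- A property of the past trace and the current state that is preserved by all steps. -/
theorem Run.invariant {P : List E → A.State → Prop}
    (external : ∀ {h s e s'}, P h s → A.trans s (.inl e) s' → P (h ++ [e]) s')
    (internal : ∀ {h s i s'}, P h s → A.trans s (.inr i) s' → P h s')
    {s s' : A.State} {h : List E} (hr : A.Run s h s') : ∀ {h₀}, P h₀ s → P (h₀ ++ h) s' := by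
  induction hr with
  | refl => intro h₀ hp; simpa using hp
  | external ht _ ih => intro h₀ hp; simpa using ih (external hp ht)
  | internal ht _ ih => intro h₀ hp; exact ih (internal hp ht)

/-! ### Runs of the product `T[L]` and of its components -/

section Product

variable {Tid Loc Val Op V J K : Type*} {T : IOA (CtxEvent Tid Loc Val Op V) J}
  {L : IOA (LibEvent Tid Op V) K}

theorem Run.fst_snd {p p' : (T.withLib L).State} {h : List (CtxEvent Tid Loc Val Op V)}
    (hr : (T.withLib L).Run p h p') :
    T.Run p.1 h p'.1 ∧ L.Run p.2 (h.filterMap CtxEvent.toLib) p'.2 := by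
  induction hr with
  | refl p => exact ⟨.refl _, .refl _⟩
  | @external p p' p'' e h ht _ ih =>
    obtain ⟨h₁, h₂⟩ := ht
    refine ⟨.external h₁ ih.1, ?_⟩
    cases he : e.toLib with
    | none =>
      simp only [he] at h₂
      simpa [he, ← h₂] using ih.2
    | some x =>
      simp only [he] at h₂
      simpa [he] using Run.external h₂ ih.2
  | @internal p p' p'' i h ht _ ih =>
    cases i with
    | inl j =>
      obtain ⟨h₁, h₂⟩ := ht
      exact ⟨.internal h₁ ih.1, h₂ ▸ ih.2⟩
    | inr k =>
      obtain ⟨h₁, h₂⟩ := ht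
      exact ⟨h₁ ▸ ih.1, .internal h₂ ih.2⟩

theorem Run.lift_lib {l l' : L.State} (s : T.State) (hr : L.Run l [] l') :
    (T.withLib L).Run (s, l) [] (s, l') := by
  generalize hg : ([] : List (LibEvent Tid Op V)) = g at hr
  induction hr with
  | refl l => exact .refl _
  | external => simp at hg
  | @internal l l₁ l₂ k _ ht _ ih =>
    exact Run.internal (A := T.withLib L) (s' := (s, l₁)) (i := .inr k) ⟨rfl, ht⟩ (ih hg)

/-- Converse of `Run.fst_snd`: runs that agree on the shared events can be interleaved, since
internal steps of one component leave the other unchanged. Internal steps of the library are delayed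
to the next shared event, the last ones to the end. -/
theorem Run.prod {s s' : T.State} {h : List (CtxEvent Tid Loc Val Op V)} (hr : T.Run s h s') :
    ∀ {l l' : L.State}, L.Run l (h.filterMap CtxEvent.toLib) l' →
      (T.withLib L).Run (s, l) h (s', l') := by
  induction hr with
  | refl s => intro l l' hl; exact hl.lift_lib s
  | @external s s₁ s₂ e h ht _ ih =>
    intro l l' hl
    cases he : e.toLib with
    | none =>
      rw [List.filterMap_cons_none he] at hl
      refine Run.external (A := T.withLib L) (s' := (s₁, l)) ⟨ht, ?_⟩ (ih hl)
      simp [he]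
    | some x =>
      rw [List.filterMap_cons_some he] at hl
      obtain ⟨l₁, l₂, h₁, h₂, h₃⟩ := hl.exists_of_cons
      refine (h₁.lift_lib s).append
        (Run.external (A := T.withLib L) (s := (s, l₁)) (s' := (s₁, l₂)) ⟨ht, ?_⟩ (ih h₃))
      simpa [he] using h₂
  | @internal s s₁ s₂ j h ht _ ih =>
    intro l l' hl
    exact Run.internal (A := T.withLib L) (s' := (s₁, l)) (i := .inl j) ⟨ht, rfl⟩ (ih hl)

/-- Products are monotone in the library: a library may be replaced by one with more traces. -/
theorem tmTraces_withLib_subset {K' : Type*} {L' : IOA (LibEvent Tid Op V) K'}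
    (hL : L.traces ⊆ L'.traces) : (T.withLib L).tmTraces ⊆ (T.withLib L').tmTraces := by
  rintro _ ⟨tr, htr, rfl⟩
  refine ⟨tr, ?_, rfl⟩
  obtain ⟨p, ⟨hp₁, hp₂⟩, p', hr⟩ := mem_traces_iff.1 htr
  obtain ⟨h₁, h₂⟩ := hr.fst_snd
  obtain ⟨l, hl, l', hr'⟩ := mem_traces_iff.1 (hL (mem_traces_iff.2 ⟨_, hp₂, _, h₂⟩))
  exact mem_traces_iff.2 ⟨(p.1, l), ⟨hp₁, hl⟩, _, h₁.prod hr'⟩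

end Product

end IOA

/-! ### Histories -/

section Histories

variable {Tid I O : Type*} {m : I → O → Prop}

theorem OpEvent.not_isInv_of_isRes {e : OpEvent Tid I O} (h : e.IsRes) : ¬ e.IsInv := by
  cases e <;> simp_all [OpEvent.IsRes, OpEvent.IsInv]

theorem Sequential.of_append_left : ∀ {a b : List (OpEvent Tid I O)}, Sequential m (a ++ b) →
    Sequential m a
  | [], _, _ => trivial
  | [_], [], h => h
  | [.inv _ _], _ :: _, _ => trivial
  | [.res _ _], _ :: _, h => h.1.elim
  | _ :: _ :: _, _, h => ⟨h.1, of_append_left h.2⟩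

/-- Invocations and responses alternate, so the parity of the number of earlier events tells whether
an operation is pending. The simulation excludes program counters in this way. -/
theorem Sequential.isInv_iff_even : ∀ {a b : List (OpEvent Tid I O)} {e : OpEvent Tid I O},
    Sequential m (a ++ e :: b) → (e.IsInv ↔ Even a.length)
  | [], [], e, h => by simpa using (show e.IsInv from h)
  | [], .res _ _ :: _, .inv _ _, _ => by simp [OpEvent.IsInv]
  | [], .inv _ _ :: _, .inv _ _, h => h.1.elim
  | [], _ :: _, .res _ _, h => h.1.elim
  | [.inv _ _], _, .res _ _, _ => by simp [OpEvent.IsInv]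
  | [.inv _ _], _, .inv _ _, h => h.1.elim
  | [.res _ _], _, _, h => h.1.elim
  | _ :: _ :: a, b, e, h => by
    have := isInv_iff_even (a := a) h.2
    simpa [Nat.even_add_one] using this

theorem Sequential.matches_of_even : ∀ {a b : List (OpEvent Tid I O)} {e f : OpEvent Tid I O},
    Sequential m (a ++ e :: f :: b) → Even a.length → e.Matches m f
  | [], _, _, _, h, _ => h.1
  | [_], _, _, _, _, h => by simp at h
  | _ :: _ :: a, b, e, f, h, ha =>
    matches_of_even (a := a) h.2 (by simpa [Nat.even_add_one] using ha)

section LegalRun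

variable {S : Type*} {R : Tid → I → S → S → O → Prop}

theorem LegalRun.append {s s' s'' : S} {h h' : List (OpEvent Tid I O)} (h₁ : LegalRun R s h s')
    (h₂ : LegalRun R s' h' s'') : LegalRun R s (h ++ h') s'' := by
  induction h₁ with
  | nil => exact h₂
  | cons hR _ ih => exact .cons hR (ih h₂)

theorem LegalRun.sequential (hm : ∀ {t i s s' o}, R t i s s' o → m i o) {s s' : S}
    {h : List (OpEvent Tid I O)} (hr : LegalRun R s h s') : Sequential m h := by
  induction hr with
  | nil => trivial
  | cons hR _ ih => exact ⟨⟨rfl, hm hR⟩, ih⟩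

theorem LegalRun.even_length {s s' : S} {h : List (OpEvent Tid I O)} (hr : LegalRun R s h s') :
    Even h.length := by
  induction hr with
  | nil => simp
  | cons _ _ ih => simpa [Nat.even_add_one] using ih

end LegalRun

variable [DecidableEq Tid]

@[simp] theorem proj_nil (t : Tid) : proj ([] : List (OpEvent Tid I O)) t = [] := rfl

@[simp] theorem proj_append (a b : List (OpEvent Tid I O)) (t : Tid) :
    proj (a ++ b) t = proj a t ++ proj b t := List.filter_append ..

theorem proj_cons (e : OpEvent Tid I O) (h : List (OpEvent Tid I O)) (t : Tid) :
    proj (e :: h) t = if e.tid = t then e :: proj h t else proj h t := by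
  simp [proj, List.filter_cons]

@[simp] theorem mem_proj {h : List (OpEvent Tid I O)} {t : Tid} {e : OpEvent Tid I O} :
    e ∈ proj h t ↔ e ∈ h ∧ e.tid = t := by
  simp [proj]

theorem proj_eq_nil {h : List (OpEvent Tid I O)} {t : Tid} :
    proj h t = [] ↔ ∀ e ∈ h, e.tid ≠ t := by
  simp [proj]

/-- An occurrence is determined by its thread and the number of earlier events of that thread; this
identifies the occurrences that `RealTime` speaks of. -/
theorem eq_of_proj_length_eq {t : Tid} : ∀ {a b c d : List (OpEvent Tid I O)}
    {e f : OpEvent Tid I O}, a ++ e :: b = c ++ f :: d → e.tid = t → f.tid = t →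
    (proj a t).length = (proj c t).length → a = c
  | [], _, [], _, _, _, _, _, _, _ => rfl
  | [], _, g :: c, _, e, _, h, he, _, hl => by
    simp only [List.nil_append, List.cons_append, List.cons.injEq] at h
    simp [proj_cons, ← h.1, he] at hl
  | g :: a, _, [], _, _, f, h, _, hf, hl => by
    simp only [List.nil_append, List.cons_append, List.cons.injEq] at h
    simp [proj_cons, h.1, hf] at hl
  | g :: a, _, g' :: c, _, _, _, h, he, hf, hl => by
    simp only [List.cons_append, List.cons.injEq] at h
    obtain ⟨rfl, h⟩ := h
    rw [eq_of_proj_length_eq h he hf]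
    by_cases hg : g.tid = t <;> simpa [proj_cons, hg] using hl

theorem exists_append_of_proj_eq {h : List (OpEvent Tid I O)} {t : Tid} {e : OpEvent Tid I O}
    {c d : List (OpEvent Tid I O)} (hp : proj h t = c ++ e :: d) :
    ∃ a b, h = a ++ e :: b ∧ proj a t = c ∧ proj b t = d ∧ e.tid = t := by
  obtain ⟨l₁, l₂, rfl, h₁, h₂⟩ := List.filter_eq_append_iff.1 hp
  obtain ⟨l₃, l₄, rfl, h₃, h₄, h₅⟩ := List.filter_eq_cons_iff.1 h₂
  refine ⟨l₁ ++ l₃, l₄, by simp, ?_, h₅, by simpa using h₄⟩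
  have : proj l₃ t = [] := proj_eq_nil.2 fun e he => by simpa using h₃ e he
  rw [proj_append, this, List.append_nil]
  exact h₁

theorem complete_sublist (h : List (OpEvent Tid I O)) : (complete m h).Sublist h := by
  induction h with
  | nil => exact List.Sublist.slnil
  | cons e h ih =>
    rw [complete]
    split_ifs
    · exact ih.cons _
    · exact ih.cons_cons _

theorem complete_res (t : Tid) (o : O) (h : List (OpEvent Tid I O)) :
    complete m (.res t o :: h) = .res t o :: complete m h := by
  rw [complete, if_neg]
  exact fun h' => h'.1

theorem complete_eq_self {h : List (OpEvent Tid I O)}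
    (hh : ∀ a e b, h = a ++ e :: b → e.IsInv → ∃ r, (proj b e.tid).head? = some r ∧
      e.Matches m r) : complete m h = h := by
  induction h with
  | nil => rfl
  | cons e h ih =>
    rw [complete, if_neg, ih]
    · intro a f b hab hf
      exact hh (e :: a) f b (by simp [hab]) hf
    · rintro ⟨he, hn⟩
      exact hn (hh [] e h rfl he)

/-- Rules out that a thread contributes to a linearization only through added responses. -/
theorem LegalRun.head_isInv {S : Type*} {R : Tid → I → S → S → O → Prop} {s s' : S}
    {h : List (OpEvent Tid I O)} (hr : LegalRun R s h s') {t : Tid} {e : OpEvent Tid I O}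
    {c : List (OpEvent Tid I O)} (hp : proj h t = e :: c) : e.IsInv := by
  induction hr with
  | nil => simp at hp
  | @cons t' i o _ _ _ h _ _ ih =>
    by_cases ht : t' = t
    · simp only [proj_cons, OpEvent.tid, ht, if_true, List.cons.injEq] at hp
      rw [← hp.1]
      trivial
    · simp only [proj_cons, OpEvent.tid, ht, if_false] at hp
      exact ih hp

end Histories

/-! ### Durably linearizable histories are traces of the durable automaton -/

section Simulation

variable {Tid Op V : Type*} [DecidableEq Tid]

/-- The state of a thread of the durable automaton during the simulation of an era: `a` is the list
of its events that have already been executed, `d` the part of the linearization that has already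
taken effect. -/
inductive ThreadSim (t : Tid) :
    List (LibOpEvent Tid Op V) → List (LibOpEvent Tid Op V) → DurPC Op V → Prop
  | idle (a : List (LibOpEvent Tid Op V)) (p : DurPC Op V) : p = .ready ∨ p = .notStarted →
      ThreadSim t a a p
  | invoked (d : List (LibOpEvent Tid Op V)) (k : Op) (x : V) :
      ThreadSim t (d ++ [.inv t (k, x)]) d (.doOp k x)
  | done (a : List (LibOpEvent Tid Op V)) (k : Op) (y : V) :
      ThreadSim t a (a ++ [.res t (k, y)]) (.resOp k y)

/-- Simulation relation inside an era. The events in `g₁` have been executed (without pending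
operations that do not take effect), `g₂` is still to be executed, `r` are the additional responses
after the era. The operations in `d₁` have taken effect, those in `d₂` have not. -/
structure EraSim (r g₁ g₂ d₁ d₂ : List (LibOpEvent Tid Op V)) (pc : Tid → DurPC Op V) : Prop where
  proj_eq : ∀ t, proj (g₁ ++ complete libMatch (g₂ ++ r)) t = proj (d₁ ++ d₂) t
  realTime : ∀ t k t' l, RealTime (g₁ ++ complete libMatch (g₂ ++ r)) t k t' l →
    RealTime (d₁ ++ d₂) t k t' l
  even : ∀ t, Even (proj d₁ t).length
  -- The first alternative is for threads that are absent from the rest of the era. Their program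
  -- counter is unconstrained: it may be `crashed`, or stay at `doOp` after an invocation that was
  -- dropped from `g₁`.
  thread : ∀ t, (proj g₂ t = [] ∧ proj d₂ t = []) ∨
    (Sequential libMatch (proj g₁ t ++ proj g₂ t) ∧ ThreadSim t (proj g₁ t) (proj d₁ t) (pc t))

namespace EraSim

variable {S : SeqObject Tid Op V} {r g₁ g₂ d₁ d₂ : List (LibOpEvent Tid Op V)}
  {pc : Tid → DurPC Op V} {t : Tid} {k : Op} {x y : V}

/-- The next operation of the linearization has been invoked, unless its invocation is among the
events that are still to be executed. -/
theorem next_invoked {i o : Op × V}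
    (h : EraSim r g₁ g₂ d₁ (.inv t i :: .res t o :: d₂) pc)
    (hn : ∀ a b, complete libMatch (g₂ ++ r) = a ++ .inv t i :: b →
      (proj (g₁ ++ a) t).length ≠ (proj d₁ t).length) :
    proj g₁ t = proj d₁ t ++ [.inv t i] ∧ pc t = .doOp i.1 i.2 ∧
      Sequential libMatch (proj g₁ t ++ proj g₂ t) := by
  have hp := h.proj_eq t
  rcases h.thread t with h' | ⟨hs, ht⟩
  · simp [proj_cons, OpEvent.tid] at h'
  · simp only [proj_append, proj_cons, OpEvent.tid, if_true] at hp hn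
    generalize proj g₁ t = A at *
    generalize proj d₁ t = D at *
    generalize pc t = P at *
    cases ht with
    -- Executed events and effects of `t` agree, so the invocation is the first event of `t` still
    -- to come, at the position that `hn` forbids.
    | idle a p hp' =>
      obtain ⟨u, v, huv, hu, -⟩ := exists_append_of_proj_eq (c := []) (List.append_cancel_left hp)
      exact (hn u v huv (by simp [hu])).elim
    | invoked d k x =>
      simp only [List.append_assoc, List.append_cancel_left_eq, List.cons_append, List.nil_append,
        List.cons.injEq] at hp
      obtain ⟨hi, -⟩ := hp
      obtain rfl := (OpEvent.inv.inj hi).2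
      exact ⟨rfl, rfl, hs⟩
    -- Here the invocation would come second, after the outstanding response of `t`; the position is
    -- again the forbidden one.
    | done a k y =>
      simp only [List.append_assoc, List.append_cancel_left_eq, List.cons_append,
        List.nil_append] at hp
      obtain ⟨u, v, huv, hu, -⟩ := exists_append_of_proj_eq (c := [.res t (k, y)]) hp
      exact (hn u v huv (by simp [hu])).elim

/-- The next operation of the linearization takes effect. -/
theorem effect (h : EraSim r g₁ g₂ d₁ (.inv t (k, x) :: .res t (k, y) :: d₂) pc)
    (hg : proj g₁ t = proj d₁ t ++ [.inv t (k, x)])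
    (hs : Sequential libMatch (proj g₁ t ++ proj g₂ t)) :
    EraSim r g₁ g₂ (d₁ ++ [.inv t (k, x), .res t (k, y)]) d₂
      (Function.update pc t (.resOp k y)) where
  proj_eq t' := by simpa using h.proj_eq t'
  realTime := by simpa using h.realTime
  even t' := by
    by_cases ht : t = t'
    · subst ht
      simpa [proj_cons, OpEvent.tid, Nat.even_add] using h.even t
    · simpa [proj_cons, OpEvent.tid, ht] using h.even t'
  thread t' := by
    by_cases ht : t = t'
    · subst ht
      refine .inr ⟨hs, ?_⟩
      have := ThreadSim.done (t := t) (proj d₁ t ++ [.inv t (k, x)]) k y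
      simpa [proj_cons, OpEvent.tid, hg] using this
    · simpa [proj_cons, OpEvent.tid, ht, Function.update_of_ne (Ne.symm ht)] using h.thread t'

/-- By parity: an invocation is next, so `t` has executed an even number of events, and its number
of events in `d₁` is always even. In the two other states exactly one of these numbers is odd. -/
theorem idle_of_inv (h : EraSim r g₁ (.inv t (k, x) :: g₂) d₁ d₂ pc) :
    proj g₁ t = proj d₁ t ∧ (pc t = .ready ∨ pc t = .notStarted) ∧
      Sequential libMatch (proj g₁ t ++ .inv t (k, x) :: proj g₂ t) := by
  have he := h.even t
  rcases h.thread t with h' | ⟨hs, ht⟩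
  · simp [proj_cons, OpEvent.tid] at h'
  · simp only [proj_cons, OpEvent.tid, if_true] at hs
    have hA := hs.isInv_iff_even.1 trivial
    generalize proj g₁ t = A at *
    generalize proj d₁ t = D at *
    generalize pc t = P at *
    cases ht with
    | idle a p hp' => exact ⟨rfl, hp', hs⟩
    | invoked => simp [Nat.even_add_one, he] at hA
    | done => simp [Nat.even_add_one, hA] at he

theorem inv_kept (h : EraSim r g₁ (.inv t (k, x) :: g₂) d₁ d₂ pc)
    (hc : complete libMatch (.inv t (k, x) :: (g₂ ++ r)) =
      .inv t (k, x) :: complete libMatch (g₂ ++ r)) :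
    EraSim r (g₁ ++ [.inv t (k, x)]) g₂ d₁ d₂ (Function.update pc t (.doOp k x)) where
  proj_eq t' := by simpa [hc] using h.proj_eq t'
  realTime := by simpa [hc] using h.realTime
  even := h.even
  thread t' := by
    by_cases ht : t = t'
    · subst ht
      obtain ⟨h₁, -, h₂⟩ := h.idle_of_inv
      refine .inr ⟨by simpa [proj_cons, OpEvent.tid] using h₂, ?_⟩
      simpa [proj_cons, OpEvent.tid, h₁] using ThreadSim.invoked (t := t) (proj d₁ t) k x
    · simpa [proj_cons, OpEvent.tid, ht, Function.update_of_ne (Ne.symm ht)] using h.thread t'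

/-- An invocation that `complete` removes is the last event of its thread in the era, for the next
one would be its matching response. Nothing of the thread is left in the linearization: it would
come from `r` and be a response, whereas by `hd` it would have to start with an invocation. So the
first alternative of `thread` applies, whatever `p` is. -/
theorem inv_dropped (h : EraSim r g₁ (.inv t (k, x) :: g₂) d₁ d₂ pc)
    (hr : ∀ e ∈ r, e.IsRes) (hd : ∀ e c, proj d₂ t = e :: c → e.IsInv)
    (hc : ¬ ∃ e, (proj (g₂ ++ r) t).head? = some e ∧
      OpEvent.Matches libMatch (.inv t (k, x)) e) (p : DurPC Op V) :
    EraSim r g₁ g₂ d₁ d₂ (Function.update pc t p) := by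
  have hc' : complete libMatch (.inv t (k, x) :: (g₂ ++ r)) = complete libMatch (g₂ ++ r) := by
    rw [complete, if_pos]
    exact ⟨trivial, hc⟩
  have hp := h.proj_eq
  simp only [List.cons_append, hc'] at hp
  refine ⟨hp, by simpa [hc'] using h.realTime, h.even, fun t' => ?_⟩
  by_cases ht : t = t'
  · subst ht
    obtain ⟨h₁, -, h₂⟩ := h.idle_of_inv
    have hg : proj g₂ t = [] := by
      cases hg : proj g₂ t with
      | nil => rfl
      | cons e c =>
        rw [hg] at h₂
        exact (hc ⟨e, by simp [hg], h₂.matches_of_even (h₁ ▸ h.even t)⟩).elim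
    refine .inl ⟨hg, ?_⟩
    cases hd' : proj d₂ t with
    | nil => rfl
    | cons e c =>
      have hpt := hp t
      rw [proj_append, proj_append, h₁, List.append_cancel_left_eq, hd'] at hpt
      have he : e ∈ proj (g₂ ++ r) t :=
        ((complete_sublist (g₂ ++ r)).filter _).subset (hpt ▸ List.mem_cons_self)
      rw [proj_append, hg, List.nil_append, mem_proj] at he
      exact (OpEvent.not_isInv_of_isRes (hr e he.1) (hd e c hd')).elim
  · simpa [proj_cons, OpEvent.tid, ht, Function.update_of_ne (Ne.symm ht)] using h.thread t'

/-- On `t`, `d₁` is one response ahead of `g₁`, and equality of the projections forces this response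
to be the one in the history. -/
theorem res_done (h : EraSim r g₁ (.res t (k, y) :: g₂) d₁ d₂ pc)
    {k' : Op} {y' : V} (hpc : pc t = .resOp k' y') :
    k' = k ∧ y' = y ∧
      EraSim r (g₁ ++ [.res t (k, y)]) g₂ d₁ d₂ (Function.update pc t .ready) := by
  have hc : complete libMatch (.res t (k, y) :: (g₂ ++ r)) =
      .res t (k, y) :: complete libMatch (g₂ ++ r) := complete_res ..
  have hp := h.proj_eq t
  rcases h.thread t with h' | ⟨hs, ht⟩
  · simp [proj_cons, OpEvent.tid] at h'
  · have hD : proj d₁ t = proj g₁ t ++ [.res t (k', y')] := by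
      rw [hpc] at ht
      generalize proj g₁ t = A at *
      generalize proj d₁ t = D at *
      cases ht with
      | idle _ _ h => simp at h
      | done => rfl
    rw [List.cons_append, hc, proj_append, proj_append, proj_cons, hD] at hp
    simp only [OpEvent.tid, if_true, List.append_assoc, List.append_cancel_left_eq,
      List.cons_append, List.nil_append, List.cons.injEq, OpEvent.res.injEq, Prod.mk.injEq,
      true_and] at hp
    obtain ⟨⟨rfl, rfl⟩, -⟩ := hp
    refine ⟨rfl, rfl, fun t' => by simpa [hc] using h.proj_eq t', by simpa [hc] using h.realTime,
      h.even, fun t' => ?_⟩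
    by_cases ht : t = t'
    · subst ht
      refine .inr ⟨by simpa [proj_cons, OpEvent.tid] using hs, ?_⟩
      simpa [proj_cons, OpEvent.tid, hD] using
        ThreadSim.idle (t := t) (proj g₁ t ++ [.res t (k, y)]) .ready (.inl rfl)
    · simpa [proj_cons, OpEvent.tid, ht, Function.update_of_ne (Ne.symm ht)] using h.thread t'

/-- Before a response the number of executed events of `t` is odd, which excludes the idle state. So
the operation is invoked, and its effect is still in `d₂`. -/
theorem invoked_of_res (h : EraSim r g₁ (.res t (k, y) :: g₂) d₁ d₂ pc)
    (hpc : ∀ k' y', pc t ≠ .resOp k' y') :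
    (proj g₁ t).length = (proj d₁ t).length + 1 ∧ d₂ ≠ [] := by
  have he := h.even t
  rcases h.thread t with h' | ⟨hs, ht⟩
  · simp [proj_cons, OpEvent.tid] at h'
  · have hp := h.proj_eq t
    simp only [proj_cons, OpEvent.tid, if_true] at hs
    have hA := hs.isInv_iff_even
    simp only [OpEvent.IsInv, false_iff] at hA
    rw [List.cons_append, complete_res, proj_append, proj_append, proj_cons] at hp
    simp only [OpEvent.tid, if_true] at hp
    generalize proj g₁ t = A at *
    generalize proj d₁ t = D at *
    generalize pc t = P at *
    cases ht with
    | idle => exact (hA he).elim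
    | invoked =>
      refine ⟨by simp, ?_⟩
      rintro rfl
      simp at hp
    | done _ k' y' => exact (hpc k' y' rfl).elim

/-- If a response is next whose operation has not yet taken effect, the next operation of the
linearization has been invoked. -/
theorem next_invoked_of_res {t' : Tid} {i o : Op × V}
    (h : EraSim r g₁ (.res t (k, y) :: g₂) d₁ (.inv t' i :: .res t' o :: d₂) pc)
    (hpc : ∀ k' y', pc t ≠ .resOp k' y') :
    proj g₁ t' = proj d₁ t' ++ [.inv t' i] ∧ pc t' = .doOp i.1 i.2 ∧
      Sequential libMatch (proj g₁ t' ++ proj (.res t (k, y) :: g₂) t') := by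
  -- If the invocation of `t'` were still to come, it would follow the response of `t` in real time.
  -- The linearization would then have this response in `d₁`, but `d₁` has one event of `t` less
  -- than `g₁`.
  refine h.next_invoked fun a b hab hl => ?_
  obtain ⟨hA, -⟩ := h.invoked_of_res hpc
  have hrt := h.realTime t (proj g₁ t).length t' (proj d₁ t').length
  rw [hab] at hrt
  cases a with
  | nil =>
    rw [List.cons_append, complete_res] at hab
    simp at hab
  | cons e a =>
    rw [List.cons_append, complete_res, List.cons_append, List.cons.injEq] at hab
    obtain ⟨rfl, -⟩ := hab
    obtain ⟨u, e₁, v, e₂, w, hd, -, he₁, hl₁, -, he₂, hl₂⟩ :=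
      hrt ⟨g₁, .res t (k, y), a, .inv t' i, b, by simp, trivial, rfl, rfl, trivial, rfl, hl⟩
    have hu := eq_of_proj_length_eq (a := d₁) (c := u ++ e₁ :: v) (t := t') (by simpa using hd)
      rfl he₂ hl₂.symm
    rw [hu] at hA
    simp [proj_cons, he₁] at hA
    omega

theorem next_invoked_of_nil {t' : Tid} {i o : Op × V}
    (h : EraSim r g₁ [] d₁ (.inv t' i :: .res t' o :: d₂) pc) (hr : ∀ e ∈ r, e.IsRes) :
    proj g₁ t' = proj d₁ t' ++ [.inv t' i] ∧ pc t' = .doOp i.1 i.2 ∧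
      Sequential libMatch (proj g₁ t' ++ proj [] t') := by
  refine h.next_invoked fun a b hab _ => ?_
  have : OpEvent.inv t' i ∈ r := (complete_sublist r).subset (by
    rw [← List.nil_append r, hab]
    simp)
  exact hr _ this

/-- Lazy scheduling: an operation of `d₂` takes effect only if the next response has not been
produced yet or the era is over, and then `next_invoked_of_res` or `next_invoked_of_nil` shows that
it is enabled. The last conclusion keeps the threads of later eras at `notStarted`. -/
theorem exists_run {s s' : S.State} (hr : ∀ e ∈ r, e.IsRes) (h : EraSim r g₁ g₂ d₁ d₂ pc)
    (hd : LegalRun S.Step s d₂ s') :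
    ∃ pc', S.durAut.Run (s, pc) (g₂.map Event.op) (s', pc') ∧
      ∀ t, proj g₂ t = [] → proj d₂ t = [] → pc' t = pc t := by
  induction hn : g₂.length + d₂.length using Nat.strong_induction_on
    generalizing s g₁ g₂ d₁ d₂ pc with
  | _ n ih =>
    have pop : ∀ {t i o d s₁}, S.Step t i s s₁ o → LegalRun S.Step s₁ d s' →
        d₂ = .inv t i :: .res t o :: d →
        (proj g₁ t = proj d₁ t ++ [.inv t i] ∧ pc t = .doOp i.1 i.2 ∧
          Sequential libMatch (proj g₁ t ++ proj g₂ t)) →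
        ∃ pc', S.durAut.Run (s, pc) (g₂.map Event.op) (s', pc') ∧
          ∀ t, proj g₂ t = [] → proj d₂ t = [] → pc' t = pc t := by
      rintro t ⟨k, x⟩ ⟨k', y⟩ d s₁ ⟨hk, hop⟩ hd' rfl ⟨h₁, h₂, h₃⟩
      obtain rfl : k = k' := hk
      obtain ⟨pc', hrun, hpc'⟩ := ih _ (by simp [← hn]) (h.effect h₁ h₃) hd' rfl
      refine ⟨pc', .internal (A := S.durAut) (.doOp h₂ hop) hrun, fun t' ht₁ ht₂ => ?_⟩
      rw [proj_cons, proj_cons] at ht₂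
      by_cases ht : t = t'
      · simp [OpEvent.tid, ht] at ht₂
      · rw [hpc' t' ht₁ (by simpa [OpEvent.tid, ht] using ht₂),
          Function.update_of_ne (Ne.symm ht)]
    rcases g₂ with _ | ⟨⟨t, k, x⟩ | ⟨t, k, y⟩, g₂⟩
    · cases hd with
      | nil => exact ⟨pc, .refl _, fun _ _ _ => rfl⟩
      | cons hop hd' => exact pop hop hd' rfl (h.next_invoked_of_nil hr)
    · obtain ⟨-, hpc, -⟩ := h.idle_of_inv
      have hsim : EraSim r (g₁ ++ [.inv t (k, x)]) g₂ d₁ d₂ (Function.update pc t (.doOp k x)) ∨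
          EraSim r g₁ g₂ d₁ d₂ (Function.update pc t (.doOp k x)) := by
        by_cases hc : ∃ e, (proj (g₂ ++ r) t).head? = some e ∧
            OpEvent.Matches libMatch (.inv t (k, x)) e
        · refine .inl (h.inv_kept ?_)
          rw [complete, if_neg]
          exact fun h' => h'.2 hc
        · exact .inr (h.inv_dropped hr (fun e c => hd.head_isInv) hc _)
      obtain ⟨g₁', hsim⟩ : ∃ g₁', EraSim r g₁' g₂ d₁ d₂ (Function.update pc t (.doOp k x)) :=
        hsim.elim (fun h => ⟨_, h⟩) fun h => ⟨_, h⟩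
      obtain ⟨pc', hrun, hpc'⟩ := ih _ (by simp [← hn]) hsim hd rfl
      refine ⟨pc', ?_, fun t' ht₁ ht₂ => ?_⟩
      · rcases hpc with hpc | hpc
        · exact .external (A := S.durAut) (.inv hpc) hrun
        -- The internal `run` step is delayed to the first invocation of the thread.
        · have hinv : S.DurStep (s, Function.update pc t .ready) (.inl (.op (.inv t (k, x))))
              (s, Function.update (Function.update pc t .ready) t (.doOp k x)) := .inv (by simp)
          rw [Function.update_idem] at hinv
          exact .internal (A := S.durAut) (.run hpc) (.external (A := S.durAut) hinv hrun)
      · by_cases ht : t = t'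
        · simp [proj_cons, OpEvent.tid, ht] at ht₁
        · rw [hpc' t' (by simpa [proj_cons, OpEvent.tid, ht] using ht₁) ht₂,
            Function.update_of_ne (Ne.symm ht)]
    · by_cases hpc : ∃ k' y', pc t = .resOp k' y'
      · obtain ⟨k', y', hpc⟩ := hpc
        obtain ⟨rfl, rfl, hsim⟩ := h.res_done hpc
        obtain ⟨pc', hrun, hpc'⟩ := ih _ (by simp [← hn]) hsim hd rfl
        refine ⟨pc', .external (A := S.durAut) (.res hpc) hrun, fun t' ht₁ ht₂ => ?_⟩
        by_cases ht : t = t'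
        · simp [proj_cons, OpEvent.tid, ht] at ht₁
        · rw [hpc' t' (by simpa [proj_cons, OpEvent.tid, ht] using ht₁) ht₂,
            Function.update_of_ne (Ne.symm ht)]
      · push Not at hpc
        cases hd with
        | nil => exact ((h.invoked_of_res hpc).2 rfl).elim
        | cons hop hd' => exact pop hop hd' rfl (h.next_invoked_of_res hpc)

end EraSim

end Simulation

/-! ### Decomposition of a history into eras -/

section Eras

variable {E : Type*}

@[simp] theorem ops_nil : ops ([] : List (Event E)) = [] := rfl

@[simp] theorem ops_cons_op (e : E) (h : List (Event E)) : ops (.op e :: h) = e :: ops h := rfl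

@[simp] theorem ops_cons_crash (h : List (Event E)) : ops (.crash :: h) = ops h := rfl

@[simp] theorem ops_append (h h' : List (Event E)) : ops (h ++ h') = ops h ++ ops h' :=
  List.filterMap_append ..

theorem eras_ne_nil (h : List (Event E)) : eras h ≠ [] := by
  match h with
  | [] => simp [eras]
  | .crash :: h => simp [eras]
  | .op e :: h =>
    rw [eras]
    split <;> simp

theorem exists_eras_op (e : E) (h : List (Event E)) :
    ∃ x xs, eras h = x :: xs ∧ eras (.op e :: h) = (e :: x) :: xs := by
  obtain ⟨x, xs, hx⟩ := List.exists_cons_of_ne_nil (eras_ne_nil h)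
  exact ⟨x, xs, hx, by rw [eras, hx]⟩

theorem ops_eq_flatten_eras (h : List (Event E)) : ops h = (eras h).flatten := by
  induction h with
  | nil => rfl
  | cons e h ih =>
    cases e with
    | crash => simpa [eras] using ih
    | op e =>
      obtain ⟨x, xs, hx, hx'⟩ := exists_eras_op e h
      simp [hx', ih, hx]

theorem eq_map_of_eras_eq_singleton {h : List (Event E)} {x : List E} (hx : eras h = [x]) :
    h = x.map .op := by
  induction h generalizing x with
  | nil => simp_all [eras]
  | cons e h ih =>
    cases e with
    | crash => simp [eras, eras_ne_nil] at hx
    | op e =>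
      obtain ⟨y, ys, hy, hy'⟩ := exists_eras_op e h
      rw [hy', List.cons.injEq] at hx
      obtain ⟨rfl, rfl⟩ := hx
      simp [ih hy]

theorem exists_of_eras_eq_cons {h : List (Event E)} {x : List E} {xs : List (List E)}
    (hx : eras h = x :: xs) (hxs : xs ≠ []) :
    ∃ h', h = x.map .op ++ .crash :: h' ∧ eras h' = xs := by
  induction h generalizing x with
  | nil => simp_all [eras]
  | cons e h ih =>
    cases e with
    | crash =>
      rw [eras, List.cons.injEq] at hx
      obtain ⟨rfl, rfl⟩ := hx
      exact ⟨h, rfl, rfl⟩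
    | op e =>
      obtain ⟨y, ys, hy, hy'⟩ := exists_eras_op e h
      rw [hy', List.cons.injEq] at hx
      obtain ⟨rfl, rfl⟩ := hx
      obtain ⟨h', rfl, hh⟩ := ih hy
      exact ⟨h', rfl, hh⟩

end Eras

/-! ### From a single era to histories with crashes -/

section Simulation

variable {Tid Op V : Type*} [DecidableEq Tid] {S : SeqObject Tid Op V}

theorem EraSim.exists_of_linearizedBy {s s' : S.State} {h hs : List (LibOpEvent Tid Op V)}
    {pc : Tid → DurPC Op V} (hl : LinearizedBy libMatch h hs) (hd : LegalRun S.Step s hs s')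
    (hseq : ∀ t, Sequential libMatch (proj h t)) (hpc : ∀ e ∈ h, pc e.tid = .notStarted) :
    ∃ pc', S.durAut.Run (s, pc) (h.map Event.op) (s', pc') ∧
      ∀ t, proj h t = [] → pc' t = pc t := by
  obtain ⟨r, hr, hp, hrt⟩ := hl
  -- A thread that is silent in `h` could contribute only added responses to `hs`, but its first
  -- event there is an invocation.
  have hnil : ∀ t, proj h t = [] → proj hs t = [] := by
    intro t ht
    cases hc : proj hs t with
    | nil => rfl
    | cons e c =>
      have he : e ∈ proj (h ++ r) t :=
        ((complete_sublist (h ++ r)).filter _).subset (by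
          change e ∈ proj (complete libMatch (h ++ r)) t
          simp [hp, hc])
      rw [proj_append, ht, List.nil_append, mem_proj] at he
      exact (OpEvent.not_isInv_of_isRes (hr e he.1) (hd.head_isInv hc)).elim
  have hsim : EraSim r [] h [] hs pc := by
    refine ⟨hp, hrt, by simp, fun t => ?_⟩
    by_cases ht : proj h t = []
    · exact .inl ⟨ht, hnil t ht⟩
    · refine .inr ⟨hseq t, .idle _ _ (.inr ?_)⟩
      obtain ⟨e, he⟩ := List.exists_mem_of_ne_nil _ ht
      obtain ⟨he', rfl⟩ := mem_proj.1 he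
      exact hpc e he'
  obtain ⟨pc', hrun, hpc'⟩ := hsim.exists_run hr hd
  exact ⟨pc', hrun, fun t ht => hpc' t ht (hnil t ht)⟩

/-- Induction over the eras. A crash disables all threads that have started, but eras have disjoint
threads, so those of later eras have not moved yet. -/
theorem SeqObject.LegalEras.exists_run {s : S.State} {hs : List (List (LibOpEvent Tid Op V))}
    (hl : S.LegalEras s hs) : ∀ {h : List (LibEvent Tid Op V)} {pc : Tid → DurPC Op V},
    List.Forall₂ (LinearizedBy libMatch) (eras h) hs →
    (∀ t, Sequential libMatch (proj (ops h) t)) →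
    (eras h).Pairwise (fun x y => ∀ e ∈ x, ∀ f ∈ y, e.tid ≠ f.tid) →
    (∀ e ∈ ops h, pc e.tid = .notStarted) → ∃ p', S.durAut.Run (s, pc) h p' := by
  induction hl with
  | last hd =>
    intro h pc hlin hseq _ hpc
    cases hx : eras h with
    | nil => exact (eras_ne_nil h hx).elim
    | cons x xs =>
      rw [hx] at hlin
      cases hlin with
      | cons hlin hnil =>
      cases hnil
      obtain rfl := eq_map_of_eras_eq_singleton hx
      simp only [ops_eq_flatten_eras, hx, List.flatten_cons, List.flatten_nil,
        List.append_nil] at hseq hpc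
      obtain ⟨pc', hrun, -⟩ := EraSim.exists_of_linearizedBy hlin hd hseq hpc
      exact ⟨_, hrun⟩
  | crash hd hrec hl ih =>
    intro h pc hlin hseq hdis hpc
    cases hx : eras h with
    | nil => exact (eras_ne_nil h hx).elim
    | cons x xs =>
      rw [hx] at hlin hdis
      cases hlin with
      | cons hlin htail =>
      have hxs : xs ≠ [] := by
        rintro rfl
        cases htail
        cases hl
      obtain ⟨h', rfl, rfl⟩ := exists_of_eras_eq_cons hx hxs
      rw [List.pairwise_cons] at hdis
      simp only [ops_eq_flatten_eras, hx, List.flatten_cons] at hseq hpc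
      simp only [← ops_eq_flatten_eras] at hseq hpc
      have hdis' : ∀ e ∈ x, ∀ f ∈ ops h', e.tid ≠ f.tid := by
        intro e he f hf
        rw [ops_eq_flatten_eras, List.mem_flatten] at hf
        obtain ⟨y, hy, hf⟩ := hf
        exact hdis.1 y hy e he f hf
      have hnil : ∀ t, proj x t = [] ∨ proj (ops h') t = [] := by
        intro t
        by_contra! hcon
        obtain ⟨⟨e, he⟩, f, hf⟩ := And.imp (List.exists_mem_of_ne_nil _)
          (List.exists_mem_of_ne_nil _) hcon
        rw [mem_proj] at he hf
        exact hdis' e he.1 f hf.1 (he.2.trans hf.2.symm)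
      obtain ⟨pc', hrun, hpc'⟩ := EraSim.exists_of_linearizedBy hlin hd
        (fun t => Sequential.of_append_left (by simpa using hseq t))
        (fun e he => hpc e (by simp [he]))
      obtain ⟨p', hrun'⟩ := ih (h := h') (pc := fun t => (pc' t).afterCrash) htail
        (fun t => by
          rcases hnil t with ht | ht
          · simpa [ht] using hseq t
          · rw [ht]
            trivial) hdis.2
        (fun e he => by
          rw [hpc' _ ((hnil e.tid).resolve_right
            (List.ne_nil_of_mem (mem_proj.2 ⟨he, rfl⟩))), hpc e (by simp [he])]
          rfl)
      exact ⟨p', hrun.append (.external (A := S.durAut) (.crashRecovery hrec) hrun')⟩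

theorem WellFormed.pairwise_eras {I O : Type*} {m : I → O → Prop}
    {h : List (Event (OpEvent Tid I O))} (hw : WellFormed m h) :
    (eras h).Pairwise (fun x y => ∀ e ∈ x, ∀ f ∈ y, e.tid ≠ f.tid) := by
  rw [List.pairwise_iff_getElem]
  intro i j hi hj hij e he f hf hef
  exact hij.ne (hw.2 i j _ _ (List.getElem?_eq_getElem hi) (List.getElem?_eq_getElem hj)
    e he f hf hef)

theorem SeqObject.DurablyLinearizable.mem_traces {h : List (LibEvent Tid Op V)}
    (hd : S.DurablyLinearizable h) : h ∈ S.durAut.traces := by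
  obtain ⟨hw, hs, ⟨s, hs₀, hl⟩, hlin⟩ := hd
  obtain ⟨p', hrun⟩ := hl.exists_run (pc := fun _ => .notStarted) hlin hw.1 hw.pairwise_eras
    fun _ _ => rfl
  exact IOA.mem_traces_iff.2 ⟨_, ⟨hs₀, fun _ => rfl⟩, p', hrun⟩

end Simulation

/-! ### Serializations of the transactions of dTMS2 -/

section Serialization

variable {Tid Loc Val : Type*}

/-- What a serialization knows about a transaction: the index of the memory that it reads from (or,
for a writer, that it generates), its read set, whether its commit has taken effect, and its effect
on the memory. -/
structure TxInfo (Loc Val : Type*) where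
  idx : ℕ
  reads : Loc → Option Val
  committed : Prop
  effect : (Loc → Val) → Loc → Val

/-- The memory after the transactions in `l`. -/
def memAfter (info : Tid → TxInfo Loc Val) (m : Loc → Val) (l : List Tid) : Loc → Val :=
  l.foldl (fun m t => (info t).effect m) m

/-- All transactions in `l` read from the memory left by their predecessors. -/
def ReadsConsistent (info : Tid → TxInfo Loc Val) : (Loc → Val) → List Tid → Prop
  | _, [] => True
  | m, t :: l => SubMem (info t).reads m ∧ ReadsConsistent info ((info t).effect m) l

variable {info info' : Tid → TxInfo Loc Val} {m m₀ : Loc → Val} {l l' ord : List Tid} {t : Tid}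

@[simp] theorem memAfter_append :
    memAfter info m (l ++ l') = memAfter info (memAfter info m l) l' :=
  List.foldl_append ..

@[simp] theorem memAfter_nil : memAfter info m [] = m := rfl

@[simp] theorem memAfter_cons :
    memAfter info m (t :: l) = memAfter info ((info t).effect m) l := rfl

theorem readsConsistent_append : ReadsConsistent info m (l ++ l') ↔
    ReadsConsistent info m l ∧ ReadsConsistent info (memAfter info m l) l' := by
  induction l generalizing m with
  | nil => simp [ReadsConsistent]
  | cons t l ih => simp [ReadsConsistent, ih, and_assoc]

theorem memAfter_congr (h : ∀ t ∈ l, (info' t).effect = (info t).effect) :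
    memAfter info' m l = memAfter info m l := by
  induction l generalizing m with
  | nil => rfl
  | cons t l ih =>
    simp only [List.mem_cons, forall_eq_or_imp] at h
    rw [memAfter_cons, memAfter_cons, h.1, ih h.2]

theorem readsConsistent_congr (h : ∀ t ∈ l, (info' t).effect = (info t).effect)
    (h' : ∀ t ∈ l, (info' t).reads = (info t).reads) :
    ReadsConsistent info' m l ↔ ReadsConsistent info m l := by
  induction l generalizing m with
  | nil => rfl
  | cons t l ih =>
    simp only [List.mem_cons, forall_eq_or_imp] at h h'
    simp only [ReadsConsistent]
    rw [h.1, h'.1, ih h.2 h'.2]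

theorem memAfter_filter_ne [DecidableEq Tid] (h : t ∈ l → (info t).effect = id) :
    memAfter info m (l.filter (· ≠ t)) = memAfter info m l := by
  induction l generalizing m with
  | nil => rfl
  | cons u l ih =>
    have ih := fun m => @ih m fun ht => h (List.mem_cons_of_mem _ ht)
    by_cases hu : u = t
    · subst hu
      rw [List.filter_cons_of_neg (by simp), ih, memAfter_cons, h List.mem_cons_self, id]
    · rw [List.filter_cons_of_pos (by simpa using hu), memAfter_cons, memAfter_cons, ih]

theorem ReadsConsistent.filter_ne [DecidableEq Tid] (hl : ReadsConsistent info m l)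
    (h : t ∈ l → (info t).effect = id) : ReadsConsistent info m (l.filter (· ≠ t)) := by
  induction l generalizing m with
  | nil => exact hl
  | cons u l ih =>
    have ih := @ih _ hl.2 fun ht => h (List.mem_cons_of_mem _ ht)
    by_cases hu : u = t
    · subst hu
      rw [h List.mem_cons_self] at ih
      rwa [List.filter_cons_of_neg (by simp)]
    · rw [List.filter_cons_of_pos (by simpa using hu)]
      exact ⟨hl.1, ih⟩

theorem filter_append_filter_not_of_pairwise_le {α : Type*} {f : α → ℕ} {l : List α} (n : ℕ)
    (h : l.Pairwise (f · ≤ f ·)) : l.filter (f · ≤ n) ++ l.filter (¬ f · ≤ n) = l := by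
  induction l with
  | nil => rfl
  | cons a l ih =>
    rw [List.pairwise_cons] at h
    by_cases ha : f a ≤ n
    · simpa [ha] using ih h.2
    · have : l.filter (f · ≤ n) = [] := by
        rw [List.filter_eq_nil_iff]
        intro b hb
        have := h.1 b hb
        simp only [decide_eq_true_eq]
        omega
      rw [List.filter_cons_of_neg (by simpa using ha), this, List.nil_append,
        List.filter_eq_self.2]
      intro b hb
      rcases List.mem_cons.1 hb with rfl | hb
      · simpa using ha
      · have := h.1 b hb
        simp only [decide_eq_true_eq]
        omega

/-- `ord` is a serialization that produces the memories `mems` and respects the order `R`. -/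
structure Serialization (m₀ : Loc → Val) (mems : List (Loc → Val)) (info : Tid → TxInfo Loc Val)
    (R : Tid → Tid → Prop) (ord : List Tid) : Prop where
  nodup : ord.Nodup
  sorted : ord.Pairwise fun t u => (info t).idx ≤ (info u).idx
  idx_lt : ∀ t ∈ ord, (info t).idx < mems.length
  -- Since `ord` is sorted, the filtered list is an initial segment: every memory is reached at some
  -- point of the serial execution.
  mem_eq : ∀ n m, mems[n]? = some m →
    memAfter info m₀ (ord.filter fun t => (info t).idx ≤ n) = m
  reads : ReadsConsistent info m₀ ord
  order : ∀ t u, R t u → [t, u].Sublist ord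

namespace Serialization

variable {mems : List (Loc → Val)} {R R' : Tid → Tid → Prop}

theorem congr (hs : Serialization m₀ mems info R ord) (hi : ∀ t ∈ ord, info' t = info t) :
    Serialization m₀ mems info' R ord where
  nodup := hs.nodup
  sorted := hs.sorted.imp_of_mem fun ht hu h => by rwa [hi _ ht, hi _ hu]
  idx_lt t ht := by rw [hi t ht]; exact hs.idx_lt t ht
  mem_eq n m hm := by
    rw [← hs.mem_eq n m hm]
    have : (ord.filter fun t => (info' t).idx ≤ n) = ord.filter fun t => (info t).idx ≤ n :=
      List.filter_congr fun t ht => by rw [hi t ht]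
    rw [this]
    exact memAfter_congr fun t ht => by rw [hi t (List.mem_of_mem_filter ht)]
  reads := (readsConsistent_congr (fun t ht => by rw [hi t ht]) fun t ht => by rw [hi t ht]).2
    hs.reads
  order := hs.order

theorem mono (hs : Serialization m₀ mems info R ord) (hR : ∀ t u, R' t u → R t u) :
    Serialization m₀ mems info R' ord :=
  { hs with order := fun t u h => hs.order t u (hR t u h) }

/-- A transaction without effect can be removed. -/
theorem erase [DecidableEq Tid] (hs : Serialization m₀ mems info R ord) (ht : t ∈ ord → (info t).effect = id) :
    Serialization m₀ mems info (fun u v => u ≠ t ∧ v ≠ t ∧ R u v) (ord.filter (· ≠ t)) where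
  nodup := hs.nodup.filter _
  sorted := hs.sorted.filter _
  idx_lt u hu := hs.idx_lt u (List.mem_of_mem_filter hu)
  mem_eq n m hm := by
    rw [List.filter_comm, memAfter_filter_ne fun h => ht (List.mem_of_mem_filter h)]
    exact hs.mem_eq n m hm
  reads := hs.reads.filter_ne ht
  order u v h := by
    have := (hs.order u v h.2.2).filter (· ≠ t)
    simpa [h.1, h.2.1] using this

/-- All indices are below `mems.length`, so the bound given by the last memory filters nothing out.
-/
theorem memAfter_eq_getLast (hs : Serialization m₀ mems info R ord)
    (hm : mems.getLast? = some m) : memAfter info m₀ ord = m := by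
  rw [List.getLast?_eq_getElem?] at hm
  rw [← hs.mem_eq _ m hm, List.filter_eq_self.2]
  intro t ht
  have := hs.idx_lt t ht
  simp only [decide_eq_true_eq]
  omega

/-- A new transaction without effect that reads from the memory with index `n` can be placed just
before the transaction that generates the next memory. -/
theorem insert (hs : Serialization m₀ mems info R ord) (ht : t ∉ ord) {n : ℕ}
    (hm : mems[n]? = some m) (hn : (info t).idx = n) (hr : SubMem (info t).reads m)
    (he : (info t).effect = id)
    (hR : ∀ u v, R' u v → R u v ∨ v = t ∧ u ∈ ord ∧ (info u).idx ≤ n) :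
    Serialization m₀ mems info R' ((ord.filter fun u => (info u).idx ≤ n) ++
      t :: ord.filter fun u => ¬ (info u).idx ≤ n) := by
  set a := ord.filter fun u => (info u).idx ≤ n with ha
  set b := ord.filter fun u => ¬ (info u).idx ≤ n with hb
  have hab : a ++ b = ord := filter_append_filter_not_of_pairwise_le n hs.sorted
  have hmem : ∀ u, u ∈ a ++ t :: b ↔ u = t ∨ u ∈ ord := by
    intro u
    rw [← hab]
    simp only [List.mem_append, List.mem_cons]
    tauto
  have hsort := hs.sorted
  have hnd := hs.nodup
  have hread := hs.reads
  rw [← hab] at hsort hnd hread ht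
  rw [List.pairwise_append] at hsort
  -- Between `a` and `b` the memory is `m`. So `t` reads correctly there and, having no effect,
  -- leaves the same memory to `b`.
  rw [readsConsistent_append, hs.mem_eq n m hm] at hread
  refine ⟨?_, ?_, ?_, ?_, ?_, ?_⟩
  · exact (List.nodup_middle).2 (List.nodup_cons.2 ⟨ht, hnd⟩)
  · rw [List.pairwise_append, List.pairwise_cons]
    refine ⟨hsort.1, ⟨fun u hu => ?_, hsort.2.1⟩, fun u hu v hv => ?_⟩
    · simp only [hb, List.mem_filter, decide_eq_true_eq] at hu
      omega
    · rcases List.mem_cons.1 hv with rfl | hv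
      · simp only [ha, List.mem_filter, decide_eq_true_eq] at hu
        omega
      · exact hsort.2.2 u hu v hv
  · intro u hu
    rcases (hmem u).1 hu with rfl | hu
    · rw [hn]
      exact (List.getElem?_eq_some_iff.1 hm).1
    · exact hs.idx_lt u hu
  · intro k m' hm'
    rw [← hs.mem_eq k m' hm', ← hab, List.filter_append, List.filter_append, List.filter_cons]
    split_ifs <;> simp [he]
  · rw [readsConsistent_append]
    refine ⟨hread.1, ?_⟩
    rw [hs.mem_eq n m hm]
    exact ⟨hr, by simpa [he] using hread.2⟩
  · intro u v huv
    rcases hR u v huv with h | ⟨rfl, hu, hle⟩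
    · refine (hs.order u v h).trans ?_
      rw [← hab]
      exact (List.Sublist.refl a).append (List.sublist_cons_self _ _)
    · have hu : u ∈ a := by simpa [ha] using ⟨hu, hle⟩
      exact (List.singleton_sublist.2 hu).append (List.singleton_sublist.2 List.mem_cons_self)

/-- A transaction without effect can be moved to another memory that is consistent with its
reads. -/
theorem move [DecidableEq Tid] (hs : Serialization m₀ mems info R ord) (ht : t ∈ ord → (info t).effect = id)
    (hi : ∀ u, u ≠ t → info' u = info u) {n : ℕ} (hm : mems[n]? = some m) (hn : (info' t).idx = n)
    (hr : SubMem (info' t).reads m) (he : (info' t).effect = id)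
    (hR : ∀ u v, R' u v → u ∈ ord ∧ u ≠ t ∧ (v ≠ t ∧ R u v ∨ v = t ∧ (info u).idx ≤ n)) :
    ∃ ord', Serialization m₀ mems info' R' ord' ∧ ∀ u, u ∈ ord' ↔ u = t ∨ u ∈ ord := by
  -- The data of `t` are changed while `t` is absent from the list; then `t` is inserted again.
  have h₁ := (hs.erase ht).congr (info' := info') fun u hu =>
    hi u (of_decide_eq_true (List.mem_filter.1 hu).2)
  refine ⟨_, h₁.insert (t := t) (R' := R') (by simp) hm hn hr he ?_, ?_⟩
  · intro u v huv
    obtain ⟨h₁, h₂, h₃⟩ := hR u v huv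
    rcases h₃ with h₃ | h₃
    · exact .inl ⟨h₂, h₃.1, h₃.2⟩
    · exact .inr ⟨h₃.1, by simp [h₁, h₂], by rw [hi u h₂]; exact h₃.2⟩
  · intro u
    by_cases hu : u = t
    · simp [hu]
    · by_cases hu' : (info' u).idx ≤ n <;> simp [hu, hu']
      intro h; omega

/-- A writing transaction is moved to the end and generates a new memory. -/
theorem push [DecidableEq Tid] (hs : Serialization m₀ mems info R ord) (ht : t ∈ ord → (info t).effect = id)
    (hi : ∀ u, u ≠ t → info' u = info u) (hm : mems.getLast? = some m)
    (hn : (info' t).idx = mems.length) (hr : SubMem (info' t).reads m)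
    (hR : ∀ u v, R' u v → u ∈ ord ∧ u ≠ t ∧ (v ≠ t ∧ R u v ∨ v = t)) :
    ∃ ord', Serialization m₀ (mems ++ [(info' t).effect m]) info' R' ord' ∧
      ∀ u, u ∈ ord' ↔ u = t ∨ u ∈ ord := by
  have h₁ := (hs.erase ht).congr (info' := info') fun u hu =>
    hi u (of_decide_eq_true (List.mem_filter.1 hu).2)
  set l := ord.filter (· ≠ t) with hl
  have hml : memAfter info' m₀ l = m := h₁.memAfter_eq_getLast hm
  have htl : t ∉ l := by simp [hl]
  refine ⟨l ++ [t], ⟨?_, ?_, ?_, ?_, ?_, ?_⟩, ?_⟩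
  · simpa [List.nodup_append] using ⟨h₁.nodup, fun u hu => by rintro rfl; exact htl hu⟩
  · rw [List.pairwise_append]
    refine ⟨h₁.sorted, by simp, fun u hu v hv => ?_⟩
    obtain rfl := List.mem_singleton.1 hv
    rw [hn]
    exact (h₁.idx_lt u hu).le
  · intro u hu
    rw [List.length_append, List.length_singleton]
    rcases List.mem_append.1 hu with hu | hu
    · have := h₁.idx_lt u hu
      omega
    · obtain rfl := List.mem_singleton.1 hu
      omega
  · intro k m' hm'
    rw [List.filter_append]
    -- With index `mems.length`, `t` does not count for the old memories, and the new one is the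
    -- last memory after the effect of `t`.
    by_cases hk : k < mems.length
    · rw [List.getElem?_append_left hk] at hm'
      rw [List.filter_cons_of_neg (by simp [hn, hk]), List.filter_nil, List.append_nil]
      exact h₁.mem_eq k m' hm'
    · have hk' : k = mems.length := by
        have := (List.getElem?_eq_some_iff.1 hm').1
        simp at this
        omega
      subst hk'
      simp only [List.getElem?_concat_length, Option.some.injEq] at hm'
      have : l.filter (fun u => (info' u).idx ≤ mems.length) = l := by
        rw [List.filter_eq_self]
        intro u hu
        simpa using (h₁.idx_lt u hu).le
      rw [this, List.filter_cons_of_pos (by simp [hn])]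
      simp [hml, hm']
  · rw [readsConsistent_append, hml]
    exact ⟨h₁.reads, hr, trivial⟩
  · intro u v huv
    obtain ⟨h₂, h₃, h₄⟩ := hR u v huv
    rcases h₄ with h₄ | rfl
    · exact (h₁.order u v ⟨h₃, h₄.1, h₄.2⟩).trans (List.sublist_append_left _ _)
    · exact (List.singleton_sublist.2 (show u ∈ l by simp [hl, h₂, h₃])).append
        (List.Sublist.refl [v])
  · intro u
    by_cases hu : u = t <;> simp [hl, hu]

/-- All memories but the last can be forgotten. -/
theorem collapse (hs : Serialization m₀ mems info R ord) (hm : mems.getLast? = some m) :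
    Serialization m₀ [m] (fun t => { info t with idx := 0 }) R ord where
  nodup := hs.nodup
  sorted := List.pairwise_of_forall fun _ _ => le_rfl
  idx_lt := by simp
  -- With all indices 0 nothing is filtered out, and the surviving memory is the outcome of the
  -- whole serialization.
  mem_eq n m' hm' := by
    have hn : n = 0 := by
      have := (List.getElem?_eq_some_iff.1 hm').1
      simp at this
      omega
    subst hn
    simp only [List.getElem?_cons_zero, Option.some.injEq] at hm'
    rw [← hm', ← hs.memAfter_eq_getLast hm]
    simp only [le_refl, decide_true, List.filter_true]
    exact memAfter_congr fun _ _ => rfl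
  reads := (readsConsistent_congr (info := info)
    (info' := fun t => { info t with idx := 0 }) (fun _ _ => rfl) fun _ _ => rfl).2 hs.reads
  order := hs.order

end Serialization

end Serialization

/-! ### The events of a single transaction -/

section Transaction

variable {Tid Loc Val : Type*}

theorem Sequential.append {I O : Type*} {m : I → O → Prop} : ∀ {a b : List (OpEvent Tid I O)},
    Sequential m a → Even a.length → Sequential m b → Sequential m (a ++ b)
  | [], _, _, _, h => h
  | [_], _, _, h, _ => by simp at h
  | _ :: _ :: _, _, h, he, h' =>
    ⟨h.1, append h.2 (by simpa [Nat.even_add_one] using he) h'⟩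

theorem TMStep.match [DecidableEq Loc] {t : Tid} {i : TMInv Loc Val} {o : TMRes Val}
    {m m' : Loc → Val} (h : TMStep t i m m' o) : tmMatch i o := by
  cases h <;> rfl

/-- The responses after which a transaction has ended. -/
def TMRes.IsFinal : TMRes Val → Prop
  | .commitOk => True
  | .abort _ => True
  | _ => False

/-- The events of transaction `t` if it is running and has no pending operation. -/
inductive Active (t : Tid) : List (TMOpEvent Tid Loc Val) → Prop
  | nil : Active t []
  | snoc {h : List (TMOpEvent Tid Loc Val)} {i : TMInv Loc Val} {o : TMRes Val} : Active t h →
      (h = [] ↔ i = .begin) → tmMatch i o → ¬ o.IsFinal → Active t (h ++ [.inv t i, .res t o])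

/-- The possible lists of events of transaction `t`. -/
def TxShape (t : Tid) (h : List (TMOpEvent Tid Loc Val)) : Prop :=
  Active t h ∨ ∃ h' i, Active t h' ∧ (h' = [] ↔ i = .begin) ∧
    (h = h' ++ [.inv t i] ∨ ∃ o, tmMatch i o ∧ h = h' ++ [.inv t i, .res t o])

variable {t : Tid} {h : List (TMOpEvent Tid Loc Val)}

theorem Active.even_length (ha : Active t h) : Even h.length := by
  induction ha with
  | nil => simp
  | snoc _ _ _ _ ih => simpa [Nat.even_add] using ih

theorem Active.sequential (ha : Active t h) : Sequential tmMatch h := by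
  induction ha with
  | nil => trivial
  | snoc ha _ hm _ ih => exact ih.append ha.even_length ⟨⟨rfl, hm⟩, trivial⟩

theorem Active.not_isFinal (ha : Active t h) {e : TMOpEvent Tid Loc Val} (he : e ∈ h) :
    ∀ u o, e = .res u o → ¬ o.IsFinal := by
  induction ha with
  | nil => simp at he
  | snoc _ _ _ ho ih =>
    simp only [List.mem_append, List.mem_cons, List.not_mem_nil, or_false] at he
    rcases he with he | rfl | rfl
    · exact ih he
    · simp
    · rintro u o' ⟨⟩
      exact ho

theorem Active.commitOk_notMem (ha : Active t h) (u : Tid) : .res u .commitOk ∉ h :=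
  fun h => ha.not_isFinal h u _ rfl trivial

theorem forall_getElem?_concat {α : Type*} {P : ℕ → α → Prop} {l : List α} {x : α}
    (hl : ∀ i e, l[i]? = some e → P i e) (hx : P l.length x) :
    ∀ i e, (l ++ [x])[i]? = some e → P i e := by
  intro i e he
  rcases lt_trichotomy i l.length with hi | rfl | hi
  · exact hl i e (by rwa [List.getElem?_append_left hi] at he)
  · simp only [List.getElem?_concat_length, Option.some.injEq] at he
    exact he ▸ hx
  · rw [List.getElem?_eq_none (by simpa using hi)] at he
    simp at he

theorem Active.zero_iff_begin (ha : Active t h) : ∀ i e, h[i]? = some e →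
    (i = 0 ↔ e = .inv t .begin) := by
  induction ha with
  | nil => simp
  | @snoc h i o _ hi _ _ ih =>
    rw [← List.singleton_append, ← List.append_assoc]
    refine forall_getElem?_concat (forall_getElem?_concat ih ?_) (by simp)
    simpa using hi

theorem TxShape.sequential (hs : TxShape t h) : Sequential tmMatch h := by
  rcases hs with ha | ⟨h', i, ha, -, rfl | ⟨o, hm, rfl⟩⟩
  · exact ha.sequential
  · exact ha.sequential.append ha.even_length trivial
  · exact ha.sequential.append ha.even_length ⟨⟨rfl, hm⟩, trivial⟩

theorem TxShape.zero_iff_begin (hs : TxShape t h) : ∀ i e, h[i]? = some e →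
    (i = 0 ↔ e = .inv t .begin) := by
  rcases hs with ha | ⟨h', i, ha, hi, rfl | ⟨o, hm, rfl⟩⟩
  · exact ha.zero_iff_begin
  · exact forall_getElem?_concat ha.zero_iff_begin (by simpa using hi)
  · rw [← List.singleton_append, ← List.append_assoc]
    exact forall_getElem?_concat (forall_getElem?_concat ha.zero_iff_begin (by simpa using hi))
      (by simp)

theorem TxShape.not_isFinal (hs : TxShape t h) {e : TMOpEvent Tid Loc Val} (he : e ∈ h.dropLast) :
    ∀ u o, e = .res u o → ¬ o.IsFinal := by
  rcases hs with ha | ⟨h', i, ha, -, rfl | ⟨o, hm, rfl⟩⟩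
  · exact ha.not_isFinal (List.mem_of_mem_dropLast he)
  · rw [List.dropLast_concat] at he
    exact ha.not_isFinal he
  · rw [← List.singleton_append, ← List.append_assoc, List.dropLast_concat] at he
    rcases List.mem_append.1 he with he | he
    · exact ha.not_isFinal he
    · rw [List.mem_singleton.1 he]
      simp

theorem transactionWellFormed_of_shape [DecidableEq Tid] {h : List (TMEvent Tid Loc Val)}
    (hs : ∀ t, TxShape t (proj (ops h) t))
    (he : ∀ (i j : ℕ) (x y : List (TMOpEvent Tid Loc Val)), (eras h)[i]? = some x →
      (eras h)[j]? = some y → ∀ e ∈ x, ∀ f ∈ y, e.tid = f.tid → i = j) :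
    TransactionWellFormed h := by
  refine ⟨⟨fun t => (hs t).sequential, he⟩, fun t i e hi => ⟨(hs t).zero_iff_begin i e hi, ?_⟩⟩
  intro hlt
  have hmem : e ∈ (proj (ops h) t).dropLast := by
    refine List.mem_of_getElem? (i := i) ?_
    rw [List.getElem?_dropLast, if_pos (by omega), hi]
  have := (hs t).not_isFinal hmem
  exact ⟨fun he => this t _ he trivial, fun k he => this t _ he trivial⟩

variable [DecidableEq Loc] {rd wr : Loc → Option Val}

/-- The operations in `h` can be executed from all memories that contain the read set, with the
write set as effect. -/
def Replayable (rd wr : Loc → Option Val) (h : List (TMOpEvent Tid Loc Val)) : Prop :=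
  ∀ m, SubMem rd m → LegalRun TMStep m h (overrideMem m wr)

theorem Replayable.snoc {i : TMInv Loc Val} {o : TMRes Val} {rd' wr' : Loc → Option Val}
    (hl : Replayable rd wr h) (hrd : ∀ m, SubMem rd' m → SubMem rd m)
    (hstep : ∀ m, SubMem rd' m → TMStep t i (overrideMem m wr) (overrideMem m wr') o) :
    Replayable rd' wr' (h ++ [.inv t i, .res t o]) :=
  fun m hm => (hl m (hrd m hm)).append (.cons (hstep m hm) (.nil _))

/-- `h` can be completed by a response such that it can be executed from all memories that contain
the read set, with the write set as effect if the transaction is committed. -/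
def Completable (t : Tid) (committed : Prop) (rd wr : Loc → Option Val)
    (h : List (TMOpEvent Tid Loc Val)) : Prop :=
  ∃ x : List (TMOpEvent Tid Loc Val), (∀ e ∈ x, e.IsRes ∧ e.tid = t) ∧
    (.res t .commitOk ∈ h ++ x ↔ committed) ∧
    ∀ m, SubMem rd m → ∃ m', LegalRun TMStep m (h ++ x) m' ∧ (committed → m' = overrideMem m wr)

/-- A pending invocation after `h`. -/
def Pending (t : Tid) (rd wr : Loc → Option Val) (i : TMInv Loc Val)
    (h : List (TMOpEvent Tid Loc Val)) : Prop :=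
  ∃ h', h = h' ++ [.inv t i] ∧ Active t h' ∧ (h' = [] ↔ i = .begin) ∧ Replayable rd wr h'

theorem Active.completable {c : Prop} (ha : Active t h) (hc : ¬ c) (hl : Replayable rd wr h) :
    Completable t c rd wr h :=
  ⟨[], by simp, by simpa [hc] using ha.commitOk_notMem t,
    fun m hm => ⟨_, by simpa using hl m hm, fun h => (hc h).elim⟩⟩

theorem Pending.shape {i : TMInv Loc Val} (hp : Pending t rd wr i h) : TxShape t h := by
  obtain ⟨h', rfl, ha, hi, -⟩ := hp
  exact .inr ⟨h', i, ha, hi, .inl rfl⟩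

theorem Pending.shape_res {i : TMInv Loc Val} {o : TMRes Val} (hp : Pending t rd wr i h)
    (hm : tmMatch i o) : TxShape t (h ++ [.res t o]) := by
  obtain ⟨h', rfl, ha, hi, -⟩ := hp
  exact .inr ⟨h', i, ha, hi, .inr ⟨o, hm, by simp⟩⟩

theorem Pending.active {i : TMInv Loc Val} {o : TMRes Val} (hp : Pending t rd wr i h)
    (hm : tmMatch i o) (ho : ¬ o.IsFinal) : Active t (h ++ [.res t o]) := by
  obtain ⟨h', rfl, ha, hi, -⟩ := hp
  simpa using ha.snoc hi hm ho

theorem Pending.mono {i : TMInv Loc Val} {rd' : Loc → Option Val} (hp : Pending t rd wr i h)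
    (hrd : ∀ m, SubMem rd' m → SubMem rd m) : Pending t rd' wr i h := by
  obtain ⟨h', rfl, ha, hi, hl⟩ := hp
  exact ⟨h', rfl, ha, hi, fun m hm => hl m (hrd m hm)⟩

theorem Pending.replayable {i : TMInv Loc Val} {o : TMRes Val} {rd' wr' : Loc → Option Val}
    (hp : Pending t rd wr i h) (hrd : ∀ m, SubMem rd' m → SubMem rd m)
    (hstep : ∀ m, SubMem rd' m → TMStep t i (overrideMem m wr) (overrideMem m wr') o) :
    Replayable rd' wr' (h ++ [.res t o]) := by
  obtain ⟨h', rfl, ha, hi, hl⟩ := hp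
  simpa using hl.snoc hrd hstep

/-- `wr'` is arbitrary because an abort makes the effect irrelevant; the write set may already
contain the write that is answered by the abort. -/
theorem Pending.completable_abort {i : TMInv Loc Val} {c : Prop} {wr' : Loc → Option Val}
    (hp : Pending t rd wr i h) (hc : ¬ c) :
    Completable t c rd wr' (h ++ [.res t (.abort i.op)]) := by
  obtain ⟨h', rfl, ha, hi, hl⟩ := hp
  refine ⟨[], by simp, ?_, fun m hm => ⟨overrideMem m wr, ?_, fun h => (hc h).elim⟩⟩
  · simpa [hc] using ha.commitOk_notMem t
  · simpa using (hl m hm).append (.cons (t := t) (.abort i _) (.nil _))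

/-- The missing response is chosen to be an abort, which is legal in every memory. -/
theorem Pending.completable {i : TMInv Loc Val} {c : Prop} {wr' : Loc → Option Val}
    (hp : Pending t rd wr i h) (hc : ¬ c) : Completable t c rd wr' h := by
  obtain ⟨h', rfl, ha, hi, hl⟩ := hp
  refine ⟨[.res t (.abort i.op)], by simp [OpEvent.IsRes, OpEvent.tid], ?_,
    fun m hm => ⟨overrideMem m wr, ?_, fun h => (hc h).elim⟩⟩
  · simpa [hc] using ha.commitOk_notMem t
  · simpa using (hl m hm).append (.cons (t := t) (.abort i _) (.nil _))

theorem Pending.completable_commitOk {c : Prop} (hp : Pending t rd wr .commit h) (hc : c) :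
    Completable t c rd wr (h ++ [.res t .commitOk]) := by
  obtain ⟨h', rfl, ha, hi, hl⟩ := hp
  refine ⟨[], by simp, by simp [hc], fun m hm => ⟨_, ?_, fun _ => rfl⟩⟩
  simpa using (hl m hm).append (.cons (t := t) (.commit _) (.nil _))

/-- The commit has taken effect, and other transactions may have read the new memory. So the missing
response must be `commitOk`. -/
theorem Pending.completable_commit {c : Prop} (hp : Pending t rd wr .commit h) (hc : c) :
    Completable t c rd wr h := by
  obtain ⟨h', rfl, ha, hi, hl⟩ := hp
  refine ⟨[.res t .commitOk], by simp [OpEvent.IsRes, OpEvent.tid], by simp [hc],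
    fun m hm => ⟨_, ?_, fun _ => rfl⟩⟩
  simpa using (hl m hm).append (.cons (t := t) (.commit _) (.nil _))

/-- The invariant of dTMS2 for the single transaction `t`: `committed` says that its commit has
taken effect, `h` are its events. -/
def TxInv (t : Tid) (committed : Prop) (rd wr : Loc → Option Val)
    (h : List (TMOpEvent Tid Loc Val)) : TMPC Loc Val → Prop
  | .notStarted => ¬ committed ∧ h = [] ∧ rd = (fun _ => none) ∧ wr = fun _ => none
  | .beginPending => ¬ committed ∧ Pending t rd wr .begin h
  | .ready => ¬ committed ∧ h ≠ [] ∧ Active t h ∧ Replayable rd wr h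
  | .doRead l => ¬ committed ∧ Pending t rd wr (.read l) h
  | .resRead v => ¬ committed ∧ (∃ l, Pending t rd wr (.read l) h) ∧
      Replayable rd wr (h ++ [.res t (.readVal v)])
  | .doWrite l v => ¬ committed ∧ Pending t rd wr (.write l v) h
  -- Up to the invocation the history replays with the earlier write set `wr'`; `wr` belongs to the
  -- history with the response added.
  | .resWrite => ¬ committed ∧ (∃ l v wr', Pending t rd wr' (.write l v) h) ∧
      Replayable rd wr (h ++ [.res t .writeOk])
  | .doCommit => ¬ committed ∧ Pending t rd wr .commit h
  | .resCommit => committed ∧ Pending t rd wr .commit h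
  | .committed => TxShape t h ∧ Completable t committed rd wr h
  -- A crash also leads here from `resCommit`, so `committed` may hold.
  | .aborted => TxShape t h ∧ Completable t committed rd wr h

variable {c : Prop} {p : TMPC Loc Val}

theorem TxInv.shape (hi : TxInv t c rd wr h p) : TxShape t h := by
  cases p with
  | notStarted => exact .inl (hi.2.1 ▸ .nil)
  | beginPending => exact hi.2.shape
  | ready => exact .inl hi.2.2.1
  | doRead => exact hi.2.shape
  | resRead => obtain ⟨-, ⟨l, hp⟩, -⟩ := hi; exact hp.shape
  | doWrite => exact hi.2.shape
  | resWrite => obtain ⟨-, ⟨l, v, wr', hp⟩, -⟩ := hi; exact hp.shape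
  | doCommit => exact hi.2.shape
  | resCommit => exact hi.2.shape
  | committed => exact hi.1
  | aborted => exact hi.1

theorem TxInv.completable (hi : TxInv t c rd wr h p) : Completable t c rd wr h := by
  cases p with
  | notStarted =>
    obtain ⟨hc, rfl, rfl, rfl⟩ := hi
    exact Active.nil.completable hc fun m _ => .nil m
  | beginPending => exact hi.2.completable hi.1
  | ready => exact hi.2.2.1.completable hi.1 hi.2.2.2
  | doRead => exact hi.2.completable hi.1
  | resRead => obtain ⟨hc, ⟨l, hp⟩, -⟩ := hi; exact hp.completable hc
  | doWrite => exact hi.2.completable hi.1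
  | resWrite => obtain ⟨hc, ⟨l, v, wr', hp⟩, -⟩ := hi; exact hp.completable hc
  | doCommit => exact hi.2.completable hi.1
  | resCommit => exact hi.2.completable_commit hi.1
  | committed => exact hi.2
  | aborted => exact hi.2

/-- A crash adds no event of `t`, and the final states ask only for `TxShape` and `Completable`,
which every state provides. -/
theorem TxInv.afterCrash (hi : TxInv t c rd wr h p) : TxInv t c rd wr h p.afterCrash := by
  have h₁ := hi.shape
  have h₂ := hi.completable
  cases p <;> first | exact hi | exact ⟨h₁, h₂⟩

theorem TxInv.ne_nil (hi : TxInv t c rd wr h p) (hh : h ≠ []) : p ≠ .notStarted := by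
  rintro rfl
  exact hh hi.2.1

theorem TxInv.beginInv (hi : TxInv t c rd wr h .notStarted) :
    TxInv t c rd wr (h ++ [.inv t .begin]) .beginPending := by
  obtain ⟨hc, rfl, rfl, rfl⟩ := hi
  exact ⟨hc, [], rfl, .nil, by simp, fun m _ => .nil m⟩

theorem TxInv.beginRes (hi : TxInv t c rd wr h .beginPending) :
    TxInv t c rd wr (h ++ [.res t .beginOk]) .ready :=
  ⟨hi.1, by simp, hi.2.active rfl id, hi.2.replayable (fun _ => id) fun _ _ => .begin _⟩

theorem TxInv.pending (hi : TxInv t c rd wr h .ready) {i : TMInv Loc Val} (hb : i ≠ .begin) :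
    ¬ c ∧ Pending t rd wr i (h ++ [.inv t i]) :=
  ⟨hi.1, h, rfl, hi.2.2.1, by simp [hi.2.1, hb], hi.2.2.2⟩

theorem TxInv.readRes {v : Val} (hi : TxInv t c rd wr h (.resRead v)) :
    TxInv t c rd wr (h ++ [.res t (.readVal v)]) .ready := by
  obtain ⟨hc, ⟨l, hp⟩, hl⟩ := hi
  exact ⟨hc, by simp, hp.active rfl id, hl⟩

theorem TxInv.writeRes (hi : TxInv t c rd wr h .resWrite) :
    TxInv t c rd wr (h ++ [.res t .writeOk]) .ready := by
  obtain ⟨hc, ⟨l, v, wr', hp⟩, hl⟩ := hi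
  exact ⟨hc, by simp, hp.active rfl id, hl⟩

theorem TxInv.commitRes (hi : TxInv t c rd wr h .resCommit) :
    TxInv t c rd wr (h ++ [.res t .commitOk]) .committed :=
  ⟨hi.2.shape_res rfl, hi.2.completable_commitOk hi.1⟩

/-- `resCommit` is not abortable, so no abort follows a commit that has taken effect. -/
theorem TxInv.exists_pending_of_abortable {k : TMOp} (hi : TxInv t c rd wr h p)
    (hk : p.abortable = some k) : ¬ c ∧ ∃ i wr', Pending t rd wr' i h ∧ i.op = k := by
  cases p <;> simp only [TMPC.abortable, Option.some.injEq, reduceCtorEq] at hk <;> subst hk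
  · exact ⟨hi.1, _, _, hi.2, rfl⟩
  · exact ⟨hi.1, _, _, hi.2, rfl⟩
  · obtain ⟨hc, ⟨l, hp⟩, -⟩ := hi
    exact ⟨hc, _, _, hp, rfl⟩
  · exact ⟨hi.1, _, _, hi.2, rfl⟩
  · obtain ⟨hc, ⟨l, v, wr', hp⟩, -⟩ := hi
    exact ⟨hc, _, _, hp, rfl⟩
  · exact ⟨hi.1, _, _, hi.2, rfl⟩

theorem TxInv.abortRes {k : TMOp} (hi : TxInv t c rd wr h p) (hk : p.abortable = some k) :
    TxInv t c rd wr (h ++ [.res t (.abort k)]) .aborted := by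
  obtain ⟨hc, i, wr', hp, rfl⟩ := hi.exists_pending_of_abortable hk
  exact ⟨hp.shape_res rfl, hp.completable_abort hc⟩

theorem TxInv.doWrite {l : Loc} {v : Val} (hi : TxInv t c rd wr h (.doWrite l v)) :
    TxInv t c rd (Function.update wr l (some v)) h .resWrite := by
  refine ⟨hi.1, ⟨l, v, wr, hi.2⟩, hi.2.replayable (fun _ => id) fun m _ => ?_⟩
  have : overrideMem m (Function.update wr l (some v)) =
      Function.update (overrideMem m wr) l v := by
    funext l'
    by_cases hl : l' = l
    · subst hl
      simp [overrideMem]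
    · simp [overrideMem, hl]
  rw [this]
  exact .write l v _

theorem TxInv.doReadOwn {l : Loc} {v : Val} (hi : TxInv t c rd wr h (.doRead l))
    (hv : wr l = some v) : TxInv t c rd wr h (.resRead v) := by
  refine ⟨hi.1, ⟨l, hi.2⟩, hi.2.replayable (fun _ => id) fun m _ => ?_⟩
  have : overrideMem m wr l = v := by simp [overrideMem, hv]
  exact this ▸ .read l _

theorem TxInv.doReadMem {l : Loc} {m : Loc → Val} (hi : TxInv t c rd wr h (.doRead l))
    (hl : wr l = none) (hm : SubMem rd m) :
    TxInv t c (Function.update rd l (some (m l))) wr h (.resRead (m l)) := by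
  have hrd : ∀ m', SubMem (Function.update rd l (some (m l))) m' → SubMem rd m' := by
    intro m' hm' l' v hv
    by_cases h : l' = l
    · subst h
      -- If the location was read before, its old value is already `m l'`, so the update does not
      -- lose it.
      rw [← hm l' v hv]
      exact hm' l' _ (by simp)
    · exact hm' l' v (by simpa [h] using hv)
  refine ⟨hi.1, ⟨l, hi.2.mono hrd⟩, hi.2.replayable hrd fun m' hm' => ?_⟩
  have : overrideMem m' wr l = m l := by simpa [overrideMem, hl] using hm' l (m l) (by simp)
  exact this ▸ .read l _

theorem TxInv.doCommit {c' : Prop} (hi : TxInv t c rd wr h .doCommit) (hc : c') :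
    TxInv t c' rd wr h .resCommit :=
  ⟨hc, hi.2⟩

end Transaction

/-! ### The invariant of dTMS2 -/

section Invariant

variable {Tid Loc Val : Type*}

/-- The transaction has begun and can still take steps. -/
def TMPC.IsLive : TMPC Loc Val → Prop
  | .notStarted => False
  | .committed => False
  | .aborted => False
  | _ => True

theorem TMPC.not_isLive_afterCrash (p : TMPC Loc Val) : ¬ p.afterCrash.IsLive := by
  cases p <;> exact id

theorem TMPC.IsLive.ne_notStarted {p : TMPC Loc Val} (h : p.IsLive) : p ≠ .notStarted := by
  rintro rfl
  exact h

theorem TMPC.isLive_of_abortable {p : TMPC Loc Val} {k : TMOp} (h : p.abortable = some k) :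
    p.IsLive := by
  cases p <;> trivial

/-- The transaction has ended. -/
def TMPC.IsOver : TMPC Loc Val → Prop
  | .committed => True
  | .aborted => True
  | _ => False

theorem TMPC.isOver_afterCrash {p : TMPC Loc Val} (h : p ≠ .notStarted) :
    p.afterCrash.IsOver := by
  cases p <;> trivial

theorem TMPC.not_isLive_of_isOver {p : TMPC Loc Val} (h : p.IsOver) : ¬ p.IsLive := by
  cases p <;> simp_all [TMPC.IsOver, TMPC.IsLive]

theorem isOver_update [DecidableEq Tid] {pc : Tid → TMPC Loc Val} {t u : Tid} {p : TMPC Loc Val}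
    (hu : ¬ (pc u).IsOver) (ht : (pc t).IsOver) : (Function.update pc u p t).IsOver := by
  rwa [Function.update_of_ne]
  rintro rfl
  exact hu ht

theorem TMRealTime.commitOk_mem {g : List (TMOpEvent Tid Loc Val)} {t u : Tid}
    (h : TMRealTime g t u) : .res t .commitOk ∈ g := by
  obtain ⟨a, b, c, rfl⟩ := h
  simp

/-- Only a begin creates new real-time pairs, and only with transactions that have already
committed. -/
theorem TMRealTime.of_concat {g : List (TMOpEvent Tid Loc Val)} {e : TMOpEvent Tid Loc Val}
    {t u : Tid} (h : TMRealTime (g ++ [e]) t u) :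
    TMRealTime g t u ∨ e = .inv u .begin ∧ .res t .commitOk ∈ g := by
  obtain ⟨a, b, c, habc⟩ := h
  rcases List.eq_nil_or_concat c with rfl | ⟨c, f, rfl⟩
  · rw [← List.cons_append, ← List.append_assoc] at habc
    obtain ⟨rfl, he⟩ := List.append_inj' habc rfl
    exact .inr ⟨by simpa using he, by simp⟩
  · refine .inl ⟨a, b, c, ?_⟩
    have : a ++ OpEvent.res t .commitOk :: (b ++ OpEvent.inv u .begin :: c.concat f) =
        (a ++ OpEvent.res t .commitOk :: (b ++ OpEvent.inv u .begin :: c)) ++ [f] := by simp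
    rw [this] at habc
    exact (List.append_inj' habc rfl).1

variable [DecidableEq Tid] [DecidableEq Loc]

/-- The invariant of dTMS2 after the events `g`, with a serialization `ord` of the transactions. -/
structure OpacityInv (m₀ : Loc → Val) (g : List (TMOpEvent Tid Loc Val))
    (s : DTMS2State Tid Loc Val) (info : Tid → TxInfo Loc Val) (ord : List Tid) : Prop where
  tx : ∀ t, TxInv t (info t).committed (s.rdSet t) (s.wrSet t) (proj g t) (s.pc t)
  reads : ∀ t, (info t).reads = s.rdSet t
  effect_committed : ∀ t, (info t).committed → (info t).effect = (overrideMem · (s.wrSet t))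
  effect_not_committed : ∀ t, ¬ (info t).committed → (info t).effect = id
  ser : Serialization m₀ s.mems info (TMRealTime g) ord
  -- Running and aborted transactions are listed too, since validity also concerns their reads.
  mem_ord : ∀ t, t ∈ ord ↔ s.pc t ≠ .notStarted
  -- For transactions that can still be moved: any index from `beginIdx` on places them behind their
  -- real-time predecessors.
  idx_le : ∀ t u, TMRealTime g t u → (s.pc u).IsLive → (info t).idx ≤ s.beginIdx u

namespace OpacityInv

variable {m₀ m : Loc → Val} {g g' : List (TMOpEvent Tid Loc Val)} {s s' : DTMS2State Tid Loc Val}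
  {info : Tid → TxInfo Loc Val} {ord : List Tid} {t u : Tid} {p : TMPC Loc Val}

theorem committed_of_mem (h : OpacityInv m₀ g s info ord) (ht : .res t .commitOk ∈ g) :
    (info t).committed := by
  obtain ⟨x, -, hx, -⟩ := (h.tx t).completable
  exact hx.1 (List.mem_append_left _ (mem_proj.2 ⟨ht, rfl⟩))

theorem mem_ord_of_mem (h : OpacityInv m₀ g s info ord) {e : TMOpEvent Tid Loc Val} (he : e ∈ g) :
    e.tid ∈ ord :=
  (h.mem_ord _).2 ((h.tx _).ne_nil (List.ne_nil_of_mem (mem_proj.2 ⟨he, rfl⟩)))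

/-- A step of `t` that does not change the serialization. -/
theorem step (h : OpacityInv m₀ g s info ord) (ht : (s.pc t).IsLive) (hp : p ≠ .notStarted)
    (hpc : s'.pc = Function.update s.pc t p) (hmems : s'.mems = s.mems)
    (hb : s'.beginIdx = s.beginIdx) (hrd : s'.rdSet = s.rdSet)
    (hwr : ∀ u, u ≠ t ∨ (info t).committed → s'.wrSet u = s.wrSet u)
    (hg : ∀ u, u ≠ t → proj g' u = proj g u)
    (hrt : ∀ u v, TMRealTime g' u v → TMRealTime g u v)
    (htx : TxInv t (info t).committed (s.rdSet t) (s'.wrSet t) (proj g' t) p) :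
    OpacityInv m₀ g' s' info ord where
  tx u := by
    by_cases hu : u = t
    · subst hu
      rw [hpc, hrd, Function.update_self]
      exact htx
    · rw [hpc, hrd, hwr u (.inl hu), hg u hu, Function.update_of_ne hu]
      exact h.tx u
  reads := hrd ▸ h.reads
  effect_committed u hc := by
    rw [hwr u, h.effect_committed u hc]
    by_cases hu : u = t
    · exact .inr (hu ▸ hc)
    · exact .inl hu
  effect_not_committed := h.effect_not_committed
  ser := hmems ▸ h.ser.mono hrt
  mem_ord u := by
    rw [h.mem_ord, hpc]
    by_cases hu : u = t
    · subst hu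
      simp [hp, ht.ne_notStarted]
    · simp [hu]
  idx_le u v huv hv := by
    rw [hb]
    refine h.idx_le u v (hrt u v huv) ?_
    by_cases hvt : v = t
    · exact hvt ▸ ht
    · rwa [hpc, Function.update_of_ne hvt] at hv

/-- An event of `t` other than its begin. -/
theorem event (h : OpacityInv m₀ g s info ord) (ht : (s.pc t).IsLive) {e : TMOpEvent Tid Loc Val}
    (het : e.tid = t) (heb : e ≠ .inv t .begin) (hp : p ≠ .notStarted)
    (htx : TxInv t (info t).committed (s.rdSet t) (s.wrSet t) (proj g t ++ [e]) p) :
    OpacityInv m₀ (g ++ [e]) (s.setPC t p) info ord := by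
  refine h.step (p := p) ht hp rfl rfl rfl rfl (fun _ _ => rfl) ?_ ?_ ?_
  · intro u hu
    simp [proj_cons, het, Ne.symm hu]
  · intro u v huv
    refine huv.of_concat.resolve_right ?_
    rintro ⟨rfl, -⟩
    exact heb (by rw [← het]; rfl)
  · simpa [proj_cons, het, DTMS2State.setPC] using htx

/-- A step of `t` that makes it read from the memory with index `n`. -/
theorem move {n : ℕ} {c : Prop} (h : OpacityInv m₀ g s info ord) (ht : (s.pc t).IsLive)
    (htc : ¬ (info t).committed)
    (hn : s.ValidIdx t n m) (hp : p ≠ .notStarted) (hpc : s'.pc = Function.update s.pc t p)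
    (hmems : s'.mems = s.mems) (hb : s'.beginIdx = s.beginIdx) (hwr : s'.wrSet = s.wrSet)
    (hrd : ∀ u, u ≠ t → s'.rdSet u = s.rdSet u) (hm : SubMem (s'.rdSet t) m)
    (hc : c → ∀ l, s.wrSet t l = none)
    (htx : TxInv t c (s'.rdSet t) (s.wrSet t) (proj g t) p) :
    ∃ info' ord', OpacityInv m₀ g s' info' ord' := by
  obtain ⟨hbn, hnm, -⟩ := hn
  set info' := Function.update info t ⟨n, s'.rdSet t, c, id⟩ with hinfo
  have hi : ∀ u, u ≠ t → info' u = info u := fun u hu => by simp [hinfo, hu]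
  have hit : info' t = ⟨n, s'.rdSet t, c, id⟩ := by simp [hinfo]
  -- As `t` has not committed, it precedes no transaction in real time; moving it can affect only
  -- pairs with `t` on the right.
  have hRne : ∀ u v, TMRealTime g u v → u ≠ t := by
    rintro u v huv rfl
    exact htc (h.committed_of_mem huv.commitOk_mem)
  obtain ⟨ord', hser, hord⟩ := h.ser.move (t := t) (info' := info') (R' := TMRealTime g) (n := n)
    (fun _ => h.effect_not_committed t htc) hi hnm (by rw [hit]) (by rw [hit]; exact hm)
    (by rw [hit]) (fun u v huv => by
      refine ⟨h.mem_ord_of_mem huv.commitOk_mem, hRne u v huv, ?_⟩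
      by_cases hv : v = t
      · exact .inr ⟨hv, (h.idx_le u v huv (hv ▸ ht)).trans (hv ▸ hbn)⟩
      · exact .inl ⟨hv, huv⟩)
  refine ⟨info', ord', ?_, ?_, ?_, ?_, hmems ▸ hser, ?_, ?_⟩
  · intro u
    by_cases hu : u = t
    · subst hu
      rw [hpc, hwr, hit, Function.update_self]
      exact htx
    · rw [hpc, hwr, hrd u hu, hi u hu, Function.update_of_ne hu]
      exact h.tx u
  · intro u
    by_cases hu : u = t
    · subst hu
      rw [hit]
    · rw [hi u hu, hrd u hu, h.reads]
  · intro u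
    by_cases hu : u = t
    · subst hu
      rw [hit, hwr]
      intro hc'
      funext m' l
      simp [overrideMem, hc hc' l]
    · rw [hi u hu, hwr]
      exact h.effect_committed u
  · intro u
    by_cases hu : u = t
    · subst hu
      rw [hit]
      exact fun _ => rfl
    · rw [hi u hu]
      exact h.effect_not_committed u
  · intro u
    rw [hord, h.mem_ord, hpc]
    by_cases hu : u = t
    · subst hu
      simp [hp]
    · simp [hu]
  · intro u v huv hv
    rw [hb, hi u (hRne u v huv)]
    refine h.idx_le u v huv ?_
    by_cases hvt : v = t
    · exact hvt ▸ ht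
    · rwa [hpc, Function.update_of_ne hvt] at hv

/-- The transaction enters at the end of the list, with the index of the last memory. This index is
at least that of every committed transaction, which establishes `idx_le`. -/
theorem beginInv (h : OpacityInv m₀ g s info ord) (ht : s.pc t = .notStarted)
    (hne : s.mems ≠ []) :
    ∃ info' ord', OpacityInv m₀ (g ++ [.inv t .begin]) { s.setPC t .beginPending with
      beginIdx := Function.update s.beginIdx t (s.mems.length - 1) } info' ord' := by
  have htx := h.tx t
  rw [ht] at htx
  obtain ⟨htc, -, hrd, -⟩ := id htx
  have hlt : s.mems.length - 1 < s.mems.length :=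
    Nat.sub_lt (List.length_pos_of_ne_nil hne) one_pos
  set info' := Function.update info t { info t with idx := s.mems.length - 1 } with hinfo
  have hi : ∀ u, u ≠ t → info' u = info u := fun u hu => by simp [hinfo, hu]
  have hit : info' t = { info t with idx := s.mems.length - 1 } := by simp [hinfo]
  have hRne : ∀ u v, TMRealTime (g ++ [.inv t .begin]) u v →
      .res u .commitOk ∈ g ∧ (v ≠ t → TMRealTime g u v) := by
    intro u v huv
    rcases huv.of_concat with huv | ⟨huv, hu⟩
    · exact ⟨huv.commitOk_mem, fun _ => huv⟩
    · exact ⟨hu, fun hv => (hv (by cases huv; rfl)).elim⟩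
  have hne' : ∀ u, .res u .commitOk ∈ g → u ≠ t := by
    rintro u hu rfl
    exact htc (h.committed_of_mem hu)
  have hidx : ∀ u, .res u .commitOk ∈ g → (info u).idx ≤ s.mems.length - 1 := fun u hu =>
    Nat.le_sub_one_of_lt (h.ser.idx_lt u (h.mem_ord_of_mem hu))
  obtain ⟨ord', hser, hord⟩ := h.ser.move (t := t) (info' := info')
    (R' := TMRealTime (g ++ [.inv t .begin])) (n := s.mems.length - 1)
    (fun _ => h.effect_not_committed t htc) hi (List.getElem?_eq_getElem hlt) (by rw [hit])
    (by
      rw [hit]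
      simp only [h.reads, hrd]
      rintro l v ⟨⟩)
    (by rw [hit]; exact h.effect_not_committed t htc) (fun u v huv => by
      obtain ⟨hu, huv⟩ := hRne u v huv
      refine ⟨h.mem_ord_of_mem hu, hne' u hu, ?_⟩
      by_cases hv : v = t
      · exact .inr ⟨hv, hidx u hu⟩
      · exact .inl ⟨hv, huv hv⟩)
  refine ⟨info', ord', ?_, ?_, ?_, ?_, hser, ?_, ?_⟩
  · intro u
    by_cases hu : u = t
    · subst hu
      simpa [DTMS2State.setPC, hit, proj_cons, OpEvent.tid] using htx.beginInv
    · simpa [DTMS2State.setPC, hi u hu, hu, proj_cons, OpEvent.tid, Ne.symm hu] using h.tx u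
  · intro u
    by_cases hu : u = t
    · subst hu
      rw [hit]
      exact h.reads u
    · rw [hi u hu]
      exact h.reads u
  · intro u
    by_cases hu : u = t
    · subst hu
      rw [hit]
      exact h.effect_committed u
    · rw [hi u hu]
      exact h.effect_committed u
  · intro u
    by_cases hu : u = t
    · subst hu
      rw [hit]
      exact h.effect_not_committed u
    · rw [hi u hu]
      exact h.effect_not_committed u
  · intro u
    rw [hord, h.mem_ord]
    by_cases hu : u = t
    · simp [hu, DTMS2State.setPC]
    · simp [hu, DTMS2State.setPC]
  · intro u v huv hv
    obtain ⟨hu, huv⟩ := hRne u v huv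
    rw [hi u (hne' u hu)]
    by_cases hvt : v = t
    · simpa [hvt] using hidx u hu
    · simp only [DTMS2State.setPC, Function.update_of_ne hvt] at hv ⊢
      exact h.idx_le u v (huv hvt) hv

/-- The read set agrees with the last memory, so `t` can move to the end, where its effect yields
the new memory. Its commit is not yet answered, so no transaction has to follow it. -/
theorem doCommitWriter (h : OpacityInv m₀ g s info ord) (ht : s.pc t = .doCommit)
    (hlast : s.mems.getLast? = some m) (hm : SubMem (s.rdSet t) m) :
    ∃ info' ord', OpacityInv m₀ g { s.setPC t .resCommit with
      mems := s.mems ++ [overrideMem m (s.wrSet t)] } info' ord' := by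
  have htx := h.tx t
  rw [ht] at htx
  have htc := htx.1
  set info' := Function.update info t
    ⟨s.mems.length, s.rdSet t, True, (overrideMem · (s.wrSet t))⟩ with hinfo
  have hi : ∀ u, u ≠ t → info' u = info u := fun u hu => by simp [hinfo, hu]
  have hit : info' t = ⟨s.mems.length, s.rdSet t, True, (overrideMem · (s.wrSet t))⟩ := by
    simp [hinfo]
  have hRne : ∀ u v, TMRealTime g u v → u ≠ t := by
    rintro u v huv rfl
    exact htc (h.committed_of_mem huv.commitOk_mem)
  obtain ⟨ord', hser, hord⟩ := h.ser.push (t := t) (info' := info') (R' := TMRealTime g)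
    (fun _ => h.effect_not_committed t htc) hi hlast (by rw [hit]) (by rw [hit]; exact hm)
    (fun u v huv => by
      refine ⟨h.mem_ord_of_mem huv.commitOk_mem, hRne u v huv, ?_⟩
      by_cases hv : v = t
      · exact .inr hv
      · exact .inl ⟨hv, huv⟩)
  rw [hit] at hser
  refine ⟨info', ord', ?_, ?_, ?_, ?_, hser, ?_, ?_⟩
  · intro u
    by_cases hu : u = t
    · subst hu
      simpa [DTMS2State.setPC, hit] using htx.doCommit trivial
    · simpa [DTMS2State.setPC, hi u hu, hu] using h.tx u
  · intro u
    by_cases hu : u = t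
    · subst hu
      rw [hit]
      rfl
    · rw [hi u hu]
      exact h.reads u
  · intro u
    by_cases hu : u = t
    · subst hu
      rw [hit]
      exact fun _ => rfl
    · rw [hi u hu]
      exact h.effect_committed u
  · intro u
    by_cases hu : u = t
    · subst hu
      rw [hit]
      exact fun hn => (hn trivial).elim
    · rw [hi u hu]
      exact h.effect_not_committed u
  · intro u
    rw [hord, h.mem_ord]
    by_cases hu : u = t
    · simp [hu, DTMS2State.setPC]
    · simp [hu, DTMS2State.setPC]
  · intro u v huv hv
    rw [hi u (hRne u v huv)]
    refine h.idx_le u v huv ?_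
    by_cases hvt : v = t
    · rw [hvt, ht]
      trivial
    · simpa [DTMS2State.setPC, hvt] using hv

/-- No transaction is live after a crash, so indices need not be compared with `beginIdx` any more
and can be reset to that of the only memory. -/
theorem crash (h : OpacityInv m₀ g s info ord) (hlast : s.mems.getLast? = some m) :
    OpacityInv m₀ g { s with pc := fun t => (s.pc t).afterCrash, mems := [m] }
      (fun t => { info t with idx := 0 }) ord where
  tx t := (h.tx t).afterCrash
  reads := h.reads
  effect_committed := h.effect_committed
  effect_not_committed := h.effect_not_committed
  ser := h.ser.collapse hlast
  mem_ord t := by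
    rw [h.mem_ord]
    cases hp : s.pc t <;> simp [hp, TMPC.afterCrash]
  idx_le _ _ _ hv := (TMPC.not_isLive_afterCrash _ hv).elim

end OpacityInv

theorem DTMS2Step.mems_ne_nil {s s' : DTMS2State Tid Loc Val} {a} (h : DTMS2Step s a s')
    (hs : s.mems ≠ []) : s'.mems ≠ [] := by
  cases h <;> first | exact hs | simp

theorem DTMS2Step.opacityInv_external {m₀ : Loc → Val} {g : List (TMOpEvent Tid Loc Val)}
    {s s' : DTMS2State Tid Loc Val} {e : TMEvent Tid Loc Val} {info : Tid → TxInfo Loc Val}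
    {ord : List Tid} (hs : DTMS2Step s (.inl e) s') (hne : s.mems ≠ [])
    (h : OpacityInv m₀ g s info ord) :
    ∃ info' ord', OpacityInv m₀ (g ++ ops [e]) s' info' ord' := by
  have htx := h.tx
  cases hs with
  | beginInv hp => exact h.beginInv hp hne
  | @beginRes t hp =>
    specialize htx t
    rw [hp] at htx
    exact ⟨_, _, h.event (by rw [hp]; trivial) rfl (by simp) (by simp) htx.beginRes⟩
  | @readInv t l hp =>
    specialize htx t
    rw [hp] at htx
    exact ⟨_, _, h.event (by rw [hp]; trivial) rfl (by simp) (by simp) (htx.pending (by simp))⟩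
  | @readRes t v hp =>
    specialize htx t
    rw [hp] at htx
    exact ⟨_, _, h.event (by rw [hp]; trivial) rfl (by simp) (by simp) htx.readRes⟩
  | @writeInv t l v hp =>
    specialize htx t
    rw [hp] at htx
    exact ⟨_, _, h.event (by rw [hp]; trivial) rfl (by simp) (by simp) (htx.pending (by simp))⟩
  | @writeRes t hp =>
    specialize htx t
    rw [hp] at htx
    exact ⟨_, _, h.event (by rw [hp]; trivial) rfl (by simp) (by simp) htx.writeRes⟩
  | @commitInv t hp =>
    specialize htx t
    rw [hp] at htx
    exact ⟨_, _, h.event (by rw [hp]; trivial) rfl (by simp) (by simp) (htx.pending (by simp))⟩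
  | @commitRes t hp =>
    specialize htx t
    rw [hp] at htx
    exact ⟨_, _, h.event (by rw [hp]; trivial) rfl (by simp) (by simp) htx.commitRes⟩
  | @abortRes t k hp =>
    exact ⟨_, _, h.event (TMPC.isLive_of_abortable hp) rfl (by simp) (by simp)
      ((htx t).abortRes hp)⟩
  | crashRecovery hm => exact ⟨_, _, by simpa using h.crash hm⟩

theorem DTMS2Step.opacityInv_internal {m₀ : Loc → Val} {g : List (TMOpEvent Tid Loc Val)}
    {s s' : DTMS2State Tid Loc Val} {i : DTMS2Internal Tid Loc Val} {info : Tid → TxInfo Loc Val}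
    {ord : List Tid} (hs : DTMS2Step s (.inr i) s') (h : OpacityInv m₀ g s info ord) :
    ∃ info' ord', OpacityInv m₀ g s' info' ord' := by
  have htx := h.tx
  cases hs with
  | @doWrite t l v hp =>
    specialize htx t
    rw [hp] at htx
    refine ⟨_, _, h.step (t := t) (by rw [hp]; trivial) (by simp) rfl rfl rfl rfl ?_
      (fun _ _ => rfl) (fun _ _ => id) (by simpa using htx.doWrite)⟩
    rintro u (hu | hu)
    · simp [hu]
    · exact (htx.1 hu).elim
  | @doCommitReadOnly t n m hp hw hv =>
    specialize htx t
    rw [hp] at htx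
    -- With an empty write set the effect remains the identity, so the commit can take effect at
    -- index `n`, not only at the end.
    exact h.move (t := t) (by rw [hp]; trivial) htx.1 hv (by simp) rfl rfl rfl rfl
      (fun _ _ => rfl) hv.2.2 (fun _ => hw) (htx.doCommit trivial)
  | @doCommitWriter t m hp hl hm => exact h.doCommitWriter hp hl hm
  | @doReadOwn t l v n hp hv =>
    specialize htx t
    rw [hp] at htx
    exact ⟨_, _, h.step (t := t) (by rw [hp]; trivial) (by simp) rfl rfl rfl rfl (fun _ _ => rfl)
      (fun _ _ => rfl) (fun _ _ => id) (htx.doReadOwn hv)⟩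
  | @doReadMem t l n m hp hw hv =>
    specialize htx t
    rw [hp] at htx
    refine h.move (t := t) (c := (info t).committed) (by rw [hp]; trivial) htx.1 hv (by simp)
      rfl rfl rfl rfl (fun u hu => by simp [hu]) ?_ (fun hc => (htx.1 hc).elim)
      (by simpa using htx.doReadMem hw hv.2.2)
    intro l' v' hv'
    by_cases hl : l' = l
    · subst hl
      simpa using hv'
    · exact hv.2.2 l' v' (by simpa [hl] using hv')

/-! ### Eras of the histories of dTMS2 -/

theorem DTMS2Step.isOver_mono {s s' : DTMS2State Tid Loc Val}
    {a : TMEvent Tid Loc Val ⊕ DTMS2Internal Tid Loc Val} (hs : DTMS2Step s a s') {t : Tid}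
    (ht : (s.pc t).IsOver) : (s'.pc t).IsOver := by
  cases hs with
  | crashRecovery => exact TMPC.isOver_afterCrash (by rintro h; rw [h] at ht; exact ht)
  | abortRes hp =>
    refine isOver_update (fun h => ?_) ht
    exact TMPC.not_isLive_of_isOver h (TMPC.isLive_of_abortable hp)
  | beginInv hp | beginRes hp | readInv hp | readRes hp | writeInv hp | writeRes hp | commitInv hp
  | commitRes hp | doWrite hp | doCommitReadOnly hp | doCommitWriter hp | doReadOwn hp
  | doReadMem hp => exact isOver_update (by rw [hp]; exact id) ht

/-- Together with `isOver_of_crash` and `isOver_mono`, this prevents a transaction from having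
events on both sides of a crash. -/
theorem DTMS2Step.not_isOver {s s' : DTMS2State Tid Loc Val} {e : TMOpEvent Tid Loc Val}
    (hs : DTMS2Step s (.inl (.op e)) s') : ¬ (s.pc e.tid).IsOver := by
  cases hs with
  | abortRes hp => exact fun h => TMPC.not_isLive_of_isOver h (TMPC.isLive_of_abortable hp)
  | beginInv hp | beginRes hp | readInv hp | readRes hp | writeInv hp | writeRes hp | commitInv hp
  | commitRes hp =>
    rw [OpEvent.tid, hp]
    exact id

theorem DTMS2Step.isOver_of_crash {s s' : DTMS2State Tid Loc Val}
    (hs : DTMS2Step s (.inl .crash) s') {t : Tid} (ht : s.pc t ≠ .notStarted) :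
    (s'.pc t).IsOver := by
  cases hs
  exact TMPC.isOver_afterCrash ht

/-- No transaction takes part in two eras, and those of previous eras have ended. -/
structure EraInv (h : List (TMEvent Tid Loc Val)) (s : DTMS2State Tid Loc Val) : Prop where
  isOver : ∀ h₁ h₂, h = h₁ ++ .crash :: h₂ → ∀ e ∈ ops h₁, (s.pc e.tid).IsOver
  disjoint : ∀ h₁ h₂, h = h₁ ++ .crash :: h₂ → ∀ e ∈ ops h₁, ∀ f ∈ ops h₂, e.tid ≠ f.tid

theorem append_singleton_eq_append_cons {α : Type*} {l a b : List α} {x y : α}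
    (h : l ++ [x] = a ++ y :: b) : (l = a ∧ x = y ∧ b = []) ∨ ∃ b', b = b' ++ [x] ∧
      l = a ++ y :: b' := by
  rcases List.eq_nil_or_concat b with rfl | ⟨b, z, rfl⟩
  · obtain ⟨h₁, h₂⟩ := List.append_inj' h rfl
    exact .inl ⟨h₁, by simpa using h₂, rfl⟩
  · rw [List.concat_eq_append, ← List.cons_append, ← List.append_assoc] at h
    obtain ⟨h₁, h₂⟩ := List.append_inj' h rfl
    obtain rfl : x = z := by simpa using h₂
    exact .inr ⟨b, by simp, h₁⟩

theorem EraInv.internal {h : List (TMEvent Tid Loc Val)} {s s' : DTMS2State Tid Loc Val}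
    {i : DTMS2Internal Tid Loc Val} (hi : EraInv h s) (hs : DTMS2Step s (.inr i) s') :
    EraInv h s' :=
  ⟨fun h₁ h₂ hh e he => hs.isOver_mono (hi.isOver h₁ h₂ hh e he), hi.disjoint⟩

theorem EraInv.external {h : List (TMEvent Tid Loc Val)} {s s' : DTMS2State Tid Loc Val}
    {e : TMEvent Tid Loc Val} (hi : EraInv h s) (hs : DTMS2Step s (.inl e) s')
    (hst : ∀ f ∈ ops h, s.pc f.tid ≠ .notStarted) : EraInv (h ++ [e]) s' := by
  constructor
  · intro h₁ h₂ hh f hf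
    rcases append_singleton_eq_append_cons hh with ⟨rfl, rfl, rfl⟩ | ⟨h₂, rfl, hh'⟩
    · exact hs.isOver_of_crash (hst f hf)
    · exact hs.isOver_mono (hi.isOver h₁ h₂ hh' f hf)
  · intro h₁ h₂ hh f hf f' hf'
    rcases append_singleton_eq_append_cons hh with ⟨rfl, rfl, rfl⟩ | ⟨h₂, rfl, hh'⟩
    · simp at hf'
    · rw [ops_append, List.mem_append] at hf'
      rcases hf' with hf' | hf'
      · exact hi.disjoint h₁ h₂ hh' f hf f' hf'
      · cases e with
        | crash => simp at hf'
        | op e =>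
          simp only [ops_cons_op, ops_nil, List.mem_singleton] at hf'
          subst hf'
          intro heq
          exact hs.not_isOver (heq ▸ hi.isOver h₁ h₂ hh' f hf)

/-- The invariant of dTMS2. -/
def HistoryInv (m₀ : Loc → Val) (h : List (TMEvent Tid Loc Val)) (s : DTMS2State Tid Loc Val) :
    Prop :=
  s.mems ≠ [] ∧ (∃ info ord, OpacityInv m₀ (ops h) s info ord) ∧ EraInv h s

theorem historyInv_start {m₀ : Loc → Val} {s : DTMS2State Tid Loc Val} (hm : s.mems = [m₀])
    (hpc : ∀ t, s.pc t = .notStarted) (hrd : ∀ t l, s.rdSet t l = none)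
    (hwr : ∀ t l, s.wrSet t l = none) : HistoryInv m₀ [] s := by
  have hrd' : ∀ t, s.rdSet t = fun _ => none := fun t => funext (hrd t)
  have hwr' : ∀ t, s.wrSet t = fun _ => none := fun t => funext (hwr t)
  have hrt : ∀ t u, ¬ TMRealTime ([] : List (TMOpEvent Tid Loc Val)) t u := by
    rintro t u ⟨a, b, c, h⟩
    simp at h
  refine ⟨by simp [hm], ⟨fun _ => ⟨0, fun _ => none, False, id⟩, [], ?_, ?_, ?_, ?_, ?_, ?_, ?_⟩,
    ?_, ?_⟩
  · intro t
    rw [hpc]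
    exact ⟨id, rfl, hrd' t, hwr' t⟩
  · intro t
    exact (hrd' t).symm
  · exact fun _ h => h.elim
  · exact fun _ _ => rfl
  · refine ⟨List.nodup_nil, List.Pairwise.nil, by simp, ?_, trivial, fun t u h => (hrt t u h).elim⟩
    intro n m h
    rw [hm] at h
    have hn := (List.getElem?_eq_some_iff.1 h).1
    obtain rfl : n = 0 := by simpa using hn
    simpa using h
  · simp [hpc]
  · exact fun t u h => (hrt t u h).elim
  · intro h₁ h₂ h
    simp at h
  · intro h₁ h₂ h
    simp at h

theorem HistoryInv.run {Init : Set (Loc → Val)} {m₀ : Loc → Val} {h h' : List (TMEvent Tid Loc Val)}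
    {s s' : DTMS2State Tid Loc Val} (hi : HistoryInv m₀ h s)
    (hr : (dTMS2 Tid Init).Run s h' s') : HistoryInv m₀ (h ++ h') s' := by
  refine hr.invariant (P := HistoryInv m₀) ?_ ?_ hi
  · rintro h s e s' ⟨hne, ⟨info, ord, hi⟩, he⟩ (hs : DTMS2Step s (.inl e) s')
    refine ⟨hs.mems_ne_nil hne, ?_, he.external hs fun f hf =>
      (hi.mem_ord _).1 (hi.mem_ord_of_mem hf)⟩
    rw [ops_append]
    exact hs.opacityInv_external hne hi
  · rintro h s i s' ⟨hne, ⟨info, ord, hi⟩, he⟩ (hs : DTMS2Step s (.inr i) s')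
    exact ⟨hs.mems_ne_nil hne, hs.opacityInv_internal hi, he.internal hs⟩

end Invariant

/-! ### Histories of dTMS2 are durably opaque -/

/-- Any two eras are separated by a crash, at which the history can be split. -/
theorem pairwise_eras_of_disjoint {Tid I O : Type*} {h : List (Event (OpEvent Tid I O))}
    (hd : ∀ h₁ h₂, h = h₁ ++ .crash :: h₂ → ∀ e ∈ ops h₁, ∀ f ∈ ops h₂, e.tid ≠ f.tid) :
    (eras h).Pairwise fun x y => ∀ e ∈ x, ∀ f ∈ y, e.tid ≠ f.tid := by
  induction h with
  | nil => simp [eras]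
  | cons e h ih =>
    have ih := ih fun h₁ h₂ hh g hg => hd (e :: h₁) h₂ (by simp [hh]) g (by
      cases e <;> simp [hg])
    cases e with
    | crash => simpa [eras] using ih
    | op e =>
      obtain ⟨x, xs, hx, hx'⟩ := exists_eras_op e h
      rw [hx, List.pairwise_cons] at ih
      rw [hx', List.pairwise_cons]
      refine ⟨fun y hy f hf g hg => ?_, ih.2⟩
      rcases List.mem_cons.1 hf with rfl | hf
      · obtain ⟨h', rfl, rfl⟩ := exists_of_eras_eq_cons hx (List.ne_nil_of_mem hy)
        refine hd (.op f :: x.map .op) h' (by simp) f (by simp) g ?_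
        rw [ops_eq_flatten_eras]
        exact List.mem_flatten.2 ⟨y, hy, hg⟩
      · exact ih.1 y hy f hf g hg

theorem eq_of_tid_eq_of_pairwise_eras {Tid I O : Type*} {h : List (Event (OpEvent Tid I O))}
    (hp : (eras h).Pairwise fun x y => ∀ e ∈ x, ∀ f ∈ y, e.tid ≠ f.tid) (i j : ℕ)
    (x y : List (OpEvent Tid I O)) (hx : (eras h)[i]? = some x) (hy : (eras h)[j]? = some y) :
    ∀ e ∈ x, ∀ f ∈ y, e.tid = f.tid → i = j := by
  intro e he f hf hef
  rw [List.pairwise_iff_getElem] at hp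
  obtain ⟨hi, rfl⟩ := List.getElem?_eq_some_iff.1 hx
  obtain ⟨hj, rfl⟩ := List.getElem?_eq_some_iff.1 hy
  rcases lt_trichotomy i j with hij | rfl | hij
  · exact (hp i j hi hj hij e he f hf hef).elim
  · rfl
  · exact (hp j i hj hi hij f hf e he hef.symm).elim

/-! ### Concatenations of blocks, one for each transaction -/

section Blocks

variable {Tid I O : Type*} {F : Tid → List (OpEvent Tid I O)} {ord : List Tid} {t : Tid}

theorem proj_flatMap [DecidableEq Tid] (hF : ∀ t, ∀ e ∈ F t, e.tid = t) (hnd : ord.Nodup) :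
    proj (ord.flatMap F) t = if t ∈ ord then F t else [] := by
  induction ord with
  | nil => rfl
  | cons u ord ih =>
    rw [List.nodup_cons] at hnd
    rw [List.flatMap_cons, proj_append, ih hnd.2]
    by_cases hu : u = t
    · subst hu
      have : proj (F u) u = F u := List.filter_eq_self.2 fun e he => by simpa using hF u e he
      simp [hnd.1, this]
    · have : proj (F u) t = [] := proj_eq_nil.2 fun e he h => hu ((hF u e he).symm.trans h)
      simp [this, Ne.symm hu]

theorem contiguous_flatMap (hF : ∀ t, ∀ e ∈ F t, e.tid = t) (hnd : ord.Nodup)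
    {h₀ h₁ h₂ : List (OpEvent Tid I O)} {e₁ e₂ : OpEvent Tid I O}
    (h : ord.flatMap F = h₀ ++ e₁ :: (h₁ ++ e₂ :: h₂)) (he : e₁.tid = e₂.tid) :
    ∀ e ∈ h₁, e.tid = e₁.tid := by
  induction ord generalizing h₀ with
  | nil => simp at h
  | cons u ord ih =>
    rw [List.nodup_cons] at hnd
    rw [List.flatMap_cons, List.append_eq_append_iff] at h
    rcases h with ⟨a, -, h⟩ | ⟨c, hc, h⟩
    · exact ih hnd.2 h
    · cases c with
      | nil => exact ih (h₀ := []) hnd.2 h.symm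
      | cons f c =>
        rw [List.cons_append, List.cons.injEq] at h
        obtain ⟨rfl, h⟩ := h
        have he₁ : e₁.tid = u := hF u e₁ (by simp [hc])
        rw [List.append_eq_append_iff] at h
        rcases h with ⟨a, rfl, -⟩ | ⟨a, -, h⟩
        · intro e hmem
          rw [he₁]
          exact hF u e (by simp [hc, hmem])
        · have : e₂ ∈ ord.flatMap F := by simp [h]
          obtain ⟨v, hv, hv'⟩ := List.mem_flatMap.1 this
          exact (hnd.1 (by rwa [← he₁, he, hF v e₂ hv'])).elim

/-- Validity looks at the history up to an event: this is a list of whole blocks and an initial part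
of the block of the event. -/
theorem exists_take_flatMap {i : ℕ} {e : OpEvent Tid I O} (h : (ord.flatMap F)[i]? = some e) :
    ∃ a t b c, ord = a ++ t :: b ∧ e ∈ F t ∧ c <+: F t ∧
      (ord.flatMap F).take (i + 1) = a.flatMap F ++ c := by
  induction ord generalizing i with
  | nil => simp at h
  | cons u ord ih =>
    rw [List.flatMap_cons] at h ⊢
    by_cases hi : i < (F u).length
    · rw [List.getElem?_append_left hi] at h
      refine ⟨[], u, ord, (F u).take (i + 1), rfl, List.mem_of_getElem? h, List.take_prefix _ _, ?_⟩
      rw [List.take_append_of_le_length hi]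
      rfl
    · rw [List.getElem?_append_right (by omega)] at h
      obtain ⟨a, t, b, c, rfl, he, hc, ht⟩ := ih h
      refine ⟨u :: a, t, b, c, rfl, he, hc, ?_⟩
      rw [List.take_append, List.take_of_length_le (by omega),
        show i + 1 - (F u).length = i - (F u).length + 1 by omega, ht]
      simp

theorem sequential_flatMap {m : I → O → Prop} (hs : ∀ t ∈ ord, Sequential m (F t))
    (he : ∀ t ∈ ord, Even (F t).length) : Sequential m (ord.flatMap F) := by
  induction ord with
  | nil => trivial
  | cons u ord ih =>
    simp only [List.mem_cons, forall_eq_or_imp] at hs he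
    exact hs.1.append he.1 (ih hs.2 he.2)

/-- The cut may separate an invocation from its response; this is the second alternative of
`TMLegal`. -/
theorem LegalRun.of_prefix {S : Type*} {R : Tid → I → S → S → O → Prop} {s s' : S}
    {h g : List (OpEvent Tid I O)} (hr : LegalRun R s h s') (hg : g <+: h) :
    (∃ s'', LegalRun R s g s'') ∨ ∃ g' t i, g = g' ++ [.inv t i] ∧ ∃ s'', LegalRun R s g' s'' := by
  induction hr generalizing g with
  | nil s =>
    obtain rfl := List.prefix_nil.1 hg
    exact .inl ⟨s, .nil s⟩
  | @cons t i o s _ _ h hR _ ih =>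
    rcases List.prefix_cons_iff.1 hg with rfl | ⟨g, rfl, hg'⟩
    · exact .inl ⟨s, .nil s⟩
    rcases List.prefix_cons_iff.1 hg' with rfl | ⟨g, rfl, hg''⟩
    · exact .inr ⟨[], t, i, rfl, s, .nil s⟩
    rcases ih hg'' with ⟨s'', h⟩ | ⟨g', t', i', rfl, s'', h⟩
    · exact .inl ⟨s'', .cons hR h⟩
    · exact .inr ⟨_, t', i', rfl, s'', .cons hR h⟩

end Blocks

/-! ### Opacity from the serialization -/

section Opacity

variable {Tid Loc Val : Type*} [DecidableEq Loc]

theorem LegalRun.tmLegal_append {m₀ m m' : Loc → Val} {l h g : List (TMOpEvent Tid Loc Val)}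
    (hl : LegalRun TMStep m₀ l m) (hr : LegalRun TMStep m h m') (hg : g <+: h) :
    TMLegal m₀ (l ++ g) := by
  rcases hr.of_prefix hg with ⟨m'', h⟩ | ⟨g', t, i, rfl, m'', h⟩
  · exact .inl ⟨m'', hl.append h⟩
  · exact .inr ⟨l ++ g', t, i, by simp, m'', hl.append h⟩

/-- In a serialization, the committed transactions can be executed one after the other. -/
theorem ReadsConsistent.legalRun {info : Tid → TxInfo Loc Val}
    {F : Tid → List (TMOpEvent Tid Loc Val)} {P : TMOpEvent Tid Loc Val → Bool} {l : List Tid}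
    {m : Loc → Val} (hl : ReadsConsistent info m l)
    (hF : ∀ t m, SubMem (info t).reads m → (info t).committed →
      LegalRun TMStep m (F t) ((info t).effect m))
    (hid : ∀ t, ¬ (info t).committed → (info t).effect = id)
    (hP : ∀ t ∈ l, ∀ e ∈ F t, P e = true ↔ (info t).committed) :
    LegalRun TMStep m ((l.flatMap F).filter P) (memAfter info m l) := by
  induction l generalizing m with
  | nil => exact .nil m
  | cons t l ih =>
    simp only [List.mem_cons, forall_eq_or_imp] at hP
    rw [List.flatMap_cons, List.filter_append]
    refine LegalRun.append ?_ (ih hl.2 hP.2)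
    by_cases hc : (info t).committed
    · rw [List.filter_eq_self.2 fun e he => (hP.1 e he).2 hc]
      exact hF t m hl.1 hc
    · rw [List.filter_eq_nil_iff.2 fun e he h => hc ((hP.1 e he).1 h)]
      simpa [hid t hc] using LegalRun.nil m

variable [DecidableEq Tid]

/-- The witness is the concatenation, in the order `ord`, of the completed transactions. The
committed transactions before `t` lead to the memory at the place of `t`, which contains its read
set, so every initial part of the block of `t` is legal. Uncommitted ones can be left out since they
have no effect. -/
theorem OpacityInv.endToEndOpaque {m₀ : Loc → Val} {g : List (TMOpEvent Tid Loc Val)}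
    {s : DTMS2State Tid Loc Val} {info : Tid → TxInfo Loc Val} {ord : List Tid}
    (h : OpacityInv m₀ g s info ord) : EndToEndOpaque m₀ g := by
  choose x hx₁ hx₂ hx₃ using fun t => (h.tx t).completable
  have hnd := h.ser.nodup
  set F : Tid → List (TMOpEvent Tid Loc Val) := fun t => proj g t ++ x t
  have hF : ∀ t, ∀ e ∈ F t, e.tid = t := by
    intro t e he
    rcases List.mem_append.1 he with he | he
    · exact (mem_proj.1 he).2
    · exact (hx₁ t e he).2
  have hlegal : ∀ a t b, ord = a ++ t :: b →
      ∃ m', LegalRun TMStep (memAfter info m₀ a) (F t) m' := by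
    rintro a t b hab
    have := h.ser.reads
    rw [hab, readsConsistent_append] at this
    obtain ⟨m', hm', -⟩ := hx₃ t _ (h.reads t ▸ this.2.1)
    exact ⟨m', hm'⟩
  have hlegal' : ∀ t ∈ ord, ∃ m m', LegalRun TMStep m (F t) m' := by
    intro t ht
    obtain ⟨a, b, hab⟩ := List.append_of_mem ht
    exact ⟨_, hlegal a t b hab⟩
  have hseq : ∀ t ∈ ord, Sequential tmMatch (F t) := fun t ht => by
    obtain ⟨m, m', hr⟩ := hlegal' t ht
    exact hr.sequential (R := TMStep) fun hs => hs.match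
  have heven : ∀ t ∈ ord, Even (F t).length := fun t ht => by
    obtain ⟨m, m', hr⟩ := hlegal' t ht
    exact hr.even_length
  have hproj : ∀ t, proj (g ++ ord.flatMap x) t = if t ∈ ord then F t else [] := by
    intro t
    rw [proj_append, proj_flatMap (fun t e he => (hx₁ t e he).2) hnd]
    split_ifs with ht
    · rfl
    · rw [List.append_nil, proj_eq_nil]
      rintro e he rfl
      exact ht (h.mem_ord_of_mem he)
  -- Every completed block is sequential and of even length, so no invocation is left without its
  -- response.
  have hcomplete : complete tmMatch (g ++ ord.flatMap x) = g ++ ord.flatMap x := by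
    refine complete_eq_self fun a e b hab he => ?_
    have hp := hproj e.tid
    rw [hab, proj_append, proj_cons, if_pos rfl] at hp
    split_ifs at hp with ht
    · have hs := hseq _ ht
      have hev := heven _ ht
      rw [← hp] at hs hev
      have ha := hs.isInv_iff_even.1 he
      cases hb : proj b e.tid with
      | nil => simp [hb, Nat.even_add_one, ha] at hev
      | cons f c =>
        rw [hb] at hs
        exact ⟨f, rfl, hs.matches_of_even ha⟩
    · simp at hp
  have hcom : ∀ t ∈ ord, Committed (ord.flatMap F) t ↔ (info t).committed := by
    intro t ht
    rw [Committed, ← hx₂ t, List.mem_flatMap]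
    constructor
    · rintro ⟨u, -, hu⟩
      obtain rfl : t = u := hF u _ hu
      exact hu
    · exact fun hu => ⟨t, ht, hu⟩
  refine ⟨ord.flatMap x, ?_, ord.flatMap F, ⟨sequential_flatMap hseq heven, ?_⟩, ?_, ?_, ?_⟩
  · intro e he
    obtain ⟨t, -, he⟩ := List.mem_flatMap.1 he
    exact (hx₁ t e he).1
  · intro h₀ e₁ h₁ e₂ h₂ hh he
    exact contiguous_flatMap hF hnd hh he
  · intro i e hi
    obtain ⟨a, t, b, c, hab, he, hc, htake⟩ := exists_take_flatMap hi
    obtain rfl := hF t e he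
    have hnd' := hnd
    have hread := h.ser.reads
    rw [hab] at hnd'
    rw [hab, readsConsistent_append] at hread
    obtain ⟨m', hm'⟩ := hlegal a e.tid b hab
    rw [htake, List.filter_append, List.filter_eq_self (l := c) |>.2 fun f hf => by
      simp [hF _ f (hc.subset hf)]]
    refine LegalRun.tmLegal_append (hread.1.legalRun ?_ h.effect_not_committed ?_) hm' hc
    · intro u m hm hu
      obtain ⟨m', hm', he⟩ := hx₃ u m (h.reads u ▸ hm)
      rw [h.effect_committed u hu]
      obtain rfl := he hu
      exact hm'
    · intro u hu f hf
      have hne : u ≠ e.tid := by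
        rintro rfl
        exact (List.nodup_middle.1 hnd').notMem (by simp [hu])
      simp [hF u f hf, hne, hcom u (by simp [hab, hu])]
  · intro t
    rw [hcomplete, hproj, proj_flatMap hF hnd]
  · intro t u htu
    -- `ord` splits between `t` and `u`, so the whole block of `t` precedes that of `u`.
    obtain ⟨r₁, r₂, hr, ht, hu⟩ := List.cons_sublist_iff.1 (h.ser.order t u htu)
    have hu := List.singleton_sublist.1 hu
    obtain ⟨a, b, c, hg⟩ := htu
    have h₁ : OpEvent.res t .commitOk ∈ r₁.flatMap F := List.mem_flatMap.2 ⟨t, ht,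
      List.mem_append_left _ (mem_proj.2 ⟨by simp [hg], rfl⟩)⟩
    have h₂ : OpEvent.inv u .begin ∈ r₂.flatMap F := List.mem_flatMap.2 ⟨u, hu,
      List.mem_append_left _ (mem_proj.2 ⟨by simp [hg], rfl⟩)⟩
    obtain ⟨a₁, b₁, h₁⟩ := List.append_of_mem h₁
    obtain ⟨a₂, b₂, h₂⟩ := List.append_of_mem h₂
    exact ⟨a₁, b₁ ++ a₂, b₂, by simp [hr, h₁, h₂]⟩

theorem exists_prefix_of_prefix_ops {E : Type*} {h : List (Event E)} {g : List E}
    (hg : g <+: ops h) : ∃ h', h' <+: h ∧ g = ops h' :=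
  List.prefix_filterMap_iff.1 hg

/-- All traces of dTMS2 are durably opaque. -/
theorem exists_durablyOpaque_of_mem_traces {Init : Set (Loc → Val)}
    {h : List (TMEvent Tid Loc Val)} (hh : h ∈ (dTMS2 Tid Init).traces) :
    ∃ m₀ ∈ Init, DurablyOpaque m₀ h := by
  obtain ⟨s, ⟨⟨m₀, hm₀, hm⟩, hpc, hrd, hwr⟩, s', hr⟩ := IOA.mem_traces_iff.1 hh
  have hi := historyInv_start hm hpc hrd hwr
  refine ⟨m₀, hm₀, ?_, fun g hg => ?_⟩
  · obtain ⟨-, ⟨info, ord, ho⟩, he⟩ := hi.run hr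
    exact transactionWellFormed_of_shape (fun t => (ho.tx t).shape)
      (eq_of_tid_eq_of_pairwise_eras (pairwise_eras_of_disjoint he.disjoint))
  · obtain ⟨h', hh', rfl⟩ := exists_prefix_of_prefix_ops hg
    obtain ⟨s'', hr'⟩ := hr.of_prefix hh'
    obtain ⟨-, ⟨info, ord, ho⟩, -⟩ := hi.run hr'
    exact ho.endToEndOpaque

end Opacity

end DurableSTM

theorem mainTheorem1 {Tid Loc Val Op V J K : Type*} [DecidableEq Tid] [DecidableEq Loc]
    (Init : Set (Loc → Val))
    (AM : DurableSTM.SeqObject Tid Op V)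
    (CM : DurableSTM.IOA (DurableSTM.LibEvent Tid Op V) K)
    (T : DurableSTM.IOA (DurableSTM.CtxEvent Tid Loc Val Op V) J)
    (hCM : ∀ h ∈ CM.traces, AM.DurablyLinearizable h)
    (hT : (T.withLib AM.durAut).tmTraces ⊆ (DurableSTM.dTMS2 Tid Init).traces) :
    ∀ h ∈ (T.withLib CM).tmTraces, ∃ m₀ ∈ Init, DurableSTM.DurablyOpaque m₀ h :=
  fun _ hh => DurableSTM.exists_durablyOpaque_of_mem_traces
    (hT (DurableSTM.IOA.tmTraces_withLib_subset (fun h hc => (hCM h hc).mem_traces) hh))
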